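/- **Setting.** Let $\rho$ be a measure on $\mathbb R$ that is not concentrated on a single point, $\Theta^o$ the interior of $\{\theta:\int e^{\theta x}\,d\rho(x)<\infty\}$, $b(\theta)=\log\int e^{\theta x}\,d\rho(x)$ and $\mathcal S=b'(\Theta^o)$. For $m\in\mathcal S$ let $\theta_m\in\Theta^o$ be given by $b'(\theta_m)=m$, let $\nu_m$ be the distribution $e^{\theta_m x-b(\theta_m)}\,d\rho(x)$ (its mean is $m$), and for $m,m'\in\mathcal S$ let $d(m,m')=(\theta_m-\theta_{m'})m-b(\theta_m)+b(\theta_{m'})$ be the Kullback–Leibler divergence between $\nu_m$ and $\nu_{m'}$. Let $K\ge2$ and $\mu=(\mu_1,\dots,\mu_K)\in\mathcal S^K$ have a unique largest entry; after relabelling, $\mu_1>\max_{a\ge2}\mu_a$. Put $$\epsilon(\mu)=\min\Big\{\tfrac14\min_{a\ne1}(\mu_1-\mu_a),\ \tfrac12\min_{a}\min\{\mu_a-\inf\mathcal S,\ \sup\mathcal S-\mu_a\}\Big\}.$$ For $m,N\in\mathbb R^K$ and arms $a\neq b$ let $$x_{a,b}(m,N)=\frac{N_am_a+N_bm_b}{N_a+N_b},\qquad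 W_{a,b}(m,N)=N_a\,d(m_a,x_{a,b}(m,N))+N_b\,d(m_b,x_{a,b}(m,N))$$ (with $W_{a,b}(m,N)=0$ if $N_a=N_b=0$), and, when $j$ is the unique maximiser of $m$, let $g(m,N)=\sum_{a\neq j}\frac{d(m_j,x_{j,a}(m,N))}{d(m_a,x_{j,a}(m,N))}-1$. **Algorithms.** Fix $\alpha\in(0,1)$. In iteration $N\ge1$ an arm $A_N$ is chosen on the basis of the past arms and rewards (and possibly an additional randomisation for breaking ties), and, given the past and $A_N$, the reward $X_N$ is drawn from $\nu_{\mu_{A_N}}$. Let $\widetilde N_a(N)$ be the number of pulls of arm $a$ in the first $N$ iterations, and $\widetilde\mu_a(N)$ the average of the rewards received from arm $a$ in them. The sampling rule of AT2 in iteration $N$ is, with $\widetilde N=\widetilde N(N-1)$ and $\widetilde\mu=\widetilde\mu(N-1)$: 1. if $\min_a\widetilde N_a<N^\alpha$, choose $A_N\in\arg\min_a\widetilde N_a$; 2. otherwise let $\hat\imath$ be the empirically best arm, $\hat\imath=\arg\max_a\widetilde\mu_a$; if $g(\widetilde\mu,\widetilde N)>0$, choose $A_N=\hat\imath$; if $g(\widetilde\mu,\widetilde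 N)\le0$, choose $A_N\in\arg\min_{a\ne\hat\imath}W_{\hat\imath,a}(\widetilde\mu,\widetilde N)$. IAT2 is the same with $\arg\min_{a\neq\hat\imath}\big(W_{\hat\imath,a}(\widetilde\mu,\widetilde N)+\log\widetilde N_a\big)$ in the last case. All ties are broken arbitrarily. In case 2, if some $\widetilde\mu_a\notin\mathcal S$ or the largest empirical mean is attained by more than one arm, then $g$ is not defined and the choice of $A_N$ may be arbitrary. The algorithms are considered without their stopping rule, which is the only place where the confidence parameter $\delta$ enters; thus nothing below depends on $\delta$. **Proposition.** The problem $\max_{\omega}\min_{a\neq1}W_{1,a}(\mu,\omega)$ over the probability simplex in $\mathbb R^K$ has a unique solution $\omega^\star$, and $\epsilon(\mu)>0$. For each of the algorithms AT2 and IAT2 and each $\alpha\in(0,1)$ there is a constant $C_1>0$, depending only on $\mu,\alpha,K$ (and on $\rho$ and on which of the two algorithms is used), such that for every process generated by the algorithm there is a random time $T_{stable}$ with $\mathbb E_\mu[T_{stable}]<\infty$ such that, almost surely, for all $N\ge T_{stable}$ and all arms $a$, $$\Big|\frac{\widetilde N_a(N)}N-\omega^\star_a\Big|\le C_1N^{-3\alpha/8}\qquad\text{and}\qquad|\widetilde\mu_a(N)-\mu_a|\le\epsilon(\mu)N^{-3\alpha/8}.$$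 -/

import Mathlib

open MeasureTheory ProbabilityTheory

noncomputable section

namespace AnchoredTopTwo

/-! ### Single parameter exponential family generated by a measure `ρ` on the real line -/

/-- The interior of `{θ | ∫ exp (θ x) dρ(x) < ∞}`. -/
def paramSpace (ρ : Measure ℝ) : Set ℝ := interior (integrableExpSet id ρ)

/-- `b(θ) = log ∫ exp (θ x) dρ(x)`. -/
def logPartition (ρ : Measure ℝ) (θ : ℝ) : ℝ := cgf id ρ θ

/-- `ρ` is non-degenerate: it is not concentrated on a single point (in particular `ρ ≠ 0`). -/
def Nondegenerate (ρ : Measure ℝ) : Prop := ∀ x : ℝ, ρ {x}ᶜ ≠ 0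

/-- The set `S` of possible means: the image of the parameter space under `b'`. -/
def meanSpace (ρ : Measure ℝ) : Set ℝ := deriv (logPartition ρ) '' paramSpace ρ

/-- `θ_m`, the parameter in the parameter space with `b'(θ_m) = m`; meaningful for `m ∈ S`. -/
def natParam (ρ : Measure ℝ) (m : ℝ) : ℝ :=
  Function.invFunOn (deriv (logPartition ρ)) (paramSpace ρ) m

/-- The member of the family with mean `m ∈ S`: its density with respect to `ρ` is
`exp (θ_m x - b(θ_m))`. -/
def armLaw (ρ : Measure ℝ) (m : ℝ) : Measure ℝ := ρ.tilted (fun x => natParam ρ m * x)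

/-- `d(m, m')`, the Kullback-Leibler divergence between the members of the family with means
`m` and `m'`; meaningful for `m, m' ∈ S`. -/
def kl (ρ : Measure ℝ) (m m' : ℝ) : ℝ :=
  (natParam ρ m - natParam ρ m') * m - logPartition ρ (natParam ρ m)
    + logPartition ρ (natParam ρ m')

/-! ### Indexes, anchor function, optimal allocation -/

variable {K : ℕ}

/-- The weighted average of the means of the arms `a` and `b` under the allocation `N`. -/
def mixMean (m N : Fin K → ℝ) (a b : Fin K) : ℝ :=
  (N a * m a + N b * m b) / (N a + N b)

/-- The index `N_a d(m_a, x_{a,b}) + N_b d(m_b, x_{a,b})`, where `x_{a,b}` is `mixMean m N a b`. -/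
def index (ρ : Measure ℝ) (m N : Fin K → ℝ) (a b : Fin K) : ℝ :=
  N a * kl ρ (m a) (mixMean m N a b) + N b * kl ρ (m b) (mixMean m N a b)

/-- The anchor function `∑_{a ≠ j} d(m_j, z_{j,a}) / d(m_a, z_{j,a}) - 1`, used when `j` is the arm
with the largest entry of `m`. -/
def anchor (ρ : Measure ℝ) (m N : Fin K → ℝ) (j : Fin K) : ℝ :=
  (∑ a ∈ Finset.univ.erase j,
    kl ρ (m j) (mixMean m N j a) / kl ρ (m a) (mixMean m N j a)) - 1

/-- `ω` solves `max_{ω ∈ Σ} min_{a ≠ i₁} (ω_{i₁} d(μ_{i₁}, x_{i₁,a}) + ω_a d(μ_a, x_{i₁,a}))`, where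
`Σ` is the probability simplex and `i₁` the best arm. -/
def IsOptimalAllocation (ρ : Measure ℝ) (μ : Fin K → ℝ) (i₁ : Fin K) (ω : Fin K → ℝ) : Prop :=
  ω ∈ stdSimplex ℝ (Fin K) ∧
    IsMaxOn (fun w : Fin K → ℝ => ⨅ a : {a : Fin K // a ≠ i₁}, index ρ μ w i₁ a)
      (stdSimplex ℝ (Fin K)) ω

/-! ### The constant `ε(μ)` -/

/-- `r_min(μ) = min_a min (μ_a - inf S) (sup S - μ_a)`, with values in `(0, ∞]`. -/
def rMin (ρ : Measure ℝ) (μ : Fin K → ℝ) : EReal :=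
  ⨅ a : Fin K, min ((μ a : EReal) - ⨅ x ∈ meanSpace ρ, (x : EReal))
    ((⨆ x ∈ meanSpace ρ, (x : EReal)) - (μ a : EReal))

/-- `Δ_min(μ) = min_{a ≠ i₁} (μ_{i₁} - μ_a)`. -/
def gapMin (μ : Fin K → ℝ) (i₁ : Fin K) : ℝ := ⨅ a : {a : Fin K // a ≠ i₁}, (μ i₁ - μ a)

/-- `ε(μ) = min (Δ_min(μ) / 4) (r_min(μ) / 2)`. -/
def epsConst (ρ : Measure ℝ) (μ : Fin K → ℝ) (i₁ : Fin K) : ℝ :=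
  (min ((gapMin μ i₁ / 4 : ℝ) : EReal) (rMin ρ μ / 2)).toReal

/-! ### The algorithms -/

/-- The two algorithms: Anchored Top-Two and Improved Anchored Top-Two. -/
inductive Variant
  | AT2
  | IAT2

/-- The quantity minimised by the challenger `a` when `j` is the empirically best arm. -/
def challengerScore (ρ : Measure ℝ) (m N : Fin K → ℝ) (j a : Fin K) : Variant → ℝ
  | Variant.AT2 => index ρ m N j a
  | Variant.IAT2 => index ρ m N j a + Real.log (N a)

/-- Arm `a` may be pulled in iteration `n + 1`, when after `n` iterations arm `b` has been pulled
`N b` times and has empirical mean `m b`.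

If some arm has been pulled less than `(n + 1)^α` times, an arm with the fewest pulls is chosen.
Otherwise the sign of the anchor function decides between the empirically best arm `j` and a
challenger of smallest score. Ties are broken arbitrarily. In the situations in which the anchor
function is not defined (an empirical mean outside `S`, or a tie for the largest empirical mean,
which gives a term `0 / 0`) no constraint is imposed, so that every convention is covered. -/
def IsChoice (v : Variant) (ρ : Measure ℝ) (α : ℝ) (n : ℕ) (N m : Fin K → ℝ) (a : Fin K) : Prop :=
  ((∃ b, N b < ((n : ℝ) + 1) ^ α) → ∀ b, N a ≤ N b) ∧
  ((∀ b, ((n : ℝ) + 1) ^ α ≤ N b) → (∀ b, m b ∈ meanSpace ρ) →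
    ∀ j, (∀ b, b ≠ j → m b < m j) →
      (0 < anchor ρ m N j → a = j) ∧
      (anchor ρ m N j ≤ 0 → a ≠ j ∧
        ∀ b, b ≠ j → challengerScore ρ m N j a v ≤ challengerScore ρ m N j b v))

variable {Ω : Type*}

/-- The number of pulls of arm `a` in the first `N` iterations; `A n` is the arm pulled in
iteration `n + 1`. -/
def pulls (A : ℕ → Ω → Fin K) (N : ℕ) (ω : Ω) (a : Fin K) : ℝ :=
  (((Finset.range N).filter (fun n => A n ω = a)).card : ℝ)

/-- The sample mean of arm `a` after `N` iterations; `X n` is the reward of iteration `n + 1`. -/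
def empMean (A : ℕ → Ω → Fin K) (X : ℕ → Ω → ℝ) (N : ℕ) (ω : Ω) (a : Fin K) : ℝ :=
  (∑ n ∈ (Finset.range N).filter (fun n => A n ω = a), X n ω) / pulls A N ω a

/-- `(A, X)` is a sequence of pulled arms and rewards produced, on the probability space `(Ω, P)`, by
the sampling rule of the algorithm `v` with exploration parameter `α` (without stopping) on the
bandit instance `μ`. Here `𝓕 n` is the information available before iteration `n + 1`: past arms and
rewards and possibly a randomisation for breaking ties. -/
structure IsRun [mΩ : MeasurableSpace Ω] (v : Variant) (ρ : Measure ℝ) (μ : Fin K → ℝ) (α : ℝ)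
    (P : Measure Ω) (𝓕 : Filtration ℕ mΩ) (A : ℕ → Ω → Fin K) (X : ℕ → Ω → ℝ) : Prop where
  measurable_arm : ∀ n, Measurable[𝓕 n] (A n)
  measurable_reward : ∀ n, Measurable[𝓕 (n + 1)] (X n)
  /-- Given the past, on the event that arm `a` is pulled, the reward has the law of arm `a`. -/
  reward_law : ∀ (n : ℕ) (a : Fin K) (E : Set Ω), MeasurableSet[𝓕 n] E → (∀ ω ∈ E, A n ω = a) →
    ∀ B : Set ℝ, MeasurableSet B → P (E ∩ X n ⁻¹' B) = P E * armLaw ρ (μ a) B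
  rule : ∀ (n : ℕ) (ω : Ω), IsChoice v ρ α n (pulls A n ω) (empMean A X n ω) (A n ω)

end AnchoredTopTwo

end

/-!
# Convergence of the anchored top-two algorithms

Write `N a` for the number of pulls of arm `a`, `i` for the best arm and `s a = N a / N i`. The
anchor function is `∑ klRatio (s a) - 1`, the index of a challenger `a` is
`N i * scaledIndex (s a)`, and both `klRatio` and `scaledIndex` are strictly increasing in the ratio
`s a`. By the intermediate value theorem (`exists_isBalanced`) there are ratios `r a` at which the
anchor function vanishes and all scaled indexes agree. The allocation proportional to `r` is the
unique optimal one: each index is bounded by a linear function tangent at this allocation, with a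
remainder that is a divergence (`IsBalanced.index_add`), and the combination of these linear
functions with weights `1 / D a` equals the total allocation because the anchor function vanishes;
here `D a` is the divergence from arm `a` to its average with the best arm at the ratio `r a`.

The rate of convergence needs no analysis of the dynamics between pulls; it suffices to look at the
last pull of each arm before time `N`, as a number of pulls does not change after it. Suppose that
from time `T` on the empirical means are within `e n = ε * n ^ (-β)` of the means.
* When a challenger is pulled the anchor function is nonpositive, which bounds its ratio; hence the
  best arm is pulled linearly often (`exists_linear_le_count`).
* When a challenger `b` is pulled, some arm has `klRatio` at most its balanced value, hence a
  scaled index at most the balanced value up to `O(e n)`; as `b` has the smallest index, monotonicity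
  gives `s b ≤ r b + O(e n)`. The logarithmic bonus of IAT2 is of smaller order. Since `n * e n` is
  increasing, `N b ≤ r b * N i + O(N * e N)` at all times (`exists_count_le`).
* When the best arm is pulled the anchor function is positive while no ratio exceeds its balanced
  value by more than `O(e n)`, so that no ratio is much smaller either (`exists_le_count`).

These implications are quantified by the sensitivity estimates for `IsRegular` functions, which are
monotone and continuously differentiable with positive derivative.

For the concentration, exploration gives every arm `(N / 2) ^ α` pulls (`exists_rpow_le_count`), and
an exponential supermartingale bounds the probability of a deviation `e N` with `β = 3 * α / 8` by
`2 * exp (-c * N ^ (α / 4))` (`IsRun.exists_measure_empMean_le`). These bounds are summable with the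
weights `N + 1`, so that a time `T` with finite mean exists (`exists_integrable_time`); the
statement then holds from a fixed multiple of `T + 1` on.
-/

namespace AnchoredTopTwo

open Set Filter Topology
open scoped ENNReal

/-! ### The exponential family -/

section ExponentialFamily

variable {ρ : Measure ℝ}

lemma isOpen_paramSpace (ρ : Measure ℝ) : IsOpen (paramSpace ρ) := isOpen_interior

lemma convex_paramSpace (ρ : Measure ℝ) : Convex ℝ (paramSpace ρ) :=
  convex_integrableExpSet.interior

lemma integrable_exp_of_mem_paramSpace {θ : ℝ} (hθ : θ ∈ paramSpace ρ) :
    Integrable (fun x : ℝ => Real.exp (θ * x)) ρ := by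
  have : θ ∈ integrableExpSet id ρ := interior_subset hθ
  exact this

lemma analyticAt_logPartition {θ : ℝ} (hθ : θ ∈ paramSpace ρ) :
    AnalyticAt ℝ (logPartition ρ) θ := analyticAt_cgf hθ

lemma Nondegenerate.ne_zero (hρ : Nondegenerate ρ) : ρ ≠ 0 := by
  rintro rfl
  exact hρ 0 rfl

/-- The second derivative of `b` is a variance, which is positive as `ρ` is not concentrated on a
point. -/
lemma deriv_deriv_logPartition_pos (hρ : Nondegenerate ρ) {θ : ℝ} (hθ : θ ∈ paramSpace ρ) :
    0 < deriv (deriv (logPartition ρ)) θ := by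
  have h := iteratedDeriv_two_cgf_eq_integral (X := id) (μ := ρ) hθ
  rw [iteratedDeriv_succ, iteratedDeriv_one] at h
  change 0 < deriv (deriv (cgf id ρ)) θ
  rw [h]
  have hint : ∀ k : ℕ, Integrable (fun x : ℝ => x ^ k * Real.exp (θ * x)) ρ := fun k =>
    integrable_pow_mul_exp_of_mem_interior_integrableExpSet (X := id) (μ := ρ) hθ k
  refine div_pos ?_ (mgf_pos' hρ.ne_zero (integrable_exp_of_mem_paramSpace hθ))
  set m := deriv (cgf id ρ) θ
  rw [integral_pos_iff_support_of_nonneg]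
  · refine pos_iff_ne_zero.2 fun h0 => hρ m (measure_mono_null (fun x hx => ?_) h0)
    have : x - m ≠ 0 := sub_ne_zero.2 hx
    simp only [id, Function.mem_support]
    positivity
  · intro x
    simp only [id, Pi.zero_apply]
    positivity
  · have := ((hint 2).sub ((hint 1).const_mul (2 * m))).add ((hint 0).const_mul (m ^ 2))
    refine this.congr (Eventually.of_forall fun x => ?_)
    simp only [id, Pi.add_apply, Pi.sub_apply]
    ring

lemma strictMonoOn_deriv_logPartition (hρ : Nondegenerate ρ) :
    StrictMonoOn (deriv (logPartition ρ)) (paramSpace ρ) := by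
  refine strictMonoOn_of_deriv_pos (convex_paramSpace ρ) ?_ ?_
  · exact fun θ hθ => (analyticAt_logPartition hθ).deriv.continuousAt.continuousWithinAt
  · intro θ hθ
    exact deriv_deriv_logPartition_pos hρ (interior_subset hθ)

lemma natParam_mem {m : ℝ} (hm : m ∈ meanSpace ρ) : natParam ρ m ∈ paramSpace ρ :=
  Function.invFunOn_mem hm

lemma deriv_logPartition_natParam {m : ℝ} (hm : m ∈ meanSpace ρ) :
    deriv (logPartition ρ) (natParam ρ m) = m :=
  Function.invFunOn_eq hm

lemma natParam_deriv_logPartition (hρ : Nondegenerate ρ) {θ : ℝ} (hθ : θ ∈ paramSpace ρ) :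
    natParam ρ (deriv (logPartition ρ) θ) = θ :=
  (strictMonoOn_deriv_logPartition hρ).injOn (natParam_mem (mem_image_of_mem _ hθ)) hθ
    (deriv_logPartition_natParam (mem_image_of_mem _ hθ))

lemma strictMonoOn_natParam (hρ : Nondegenerate ρ) : StrictMonoOn (natParam ρ) (meanSpace ρ) := by
  intro m hm m' hm' h
  rw [← (strictMonoOn_deriv_logPartition hρ).lt_iff_lt (natParam_mem hm) (natParam_mem hm'),
    deriv_logPartition_natParam hm, deriv_logPartition_natParam hm']
  exact h

lemma ordConnected_meanSpace (ρ : Measure ℝ) : (meanSpace ρ).OrdConnected := by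
  refine IsPreconnected.ordConnected ((convex_paramSpace ρ).isPreconnected.image _ ?_)
  exact fun θ hθ => (analyticAt_logPartition hθ).deriv.continuousAt.continuousWithinAt

lemma hasStrictDerivAt_deriv_logPartition {θ : ℝ} (hθ : θ ∈ paramSpace ρ) :
    HasStrictDerivAt (deriv (logPartition ρ)) (deriv (deriv (logPartition ρ)) θ) θ :=
  (analyticAt_logPartition hθ).deriv.hasStrictDerivAt

lemma isOpen_meanSpace (hρ : Nondegenerate ρ) : IsOpen (meanSpace ρ) := by
  rw [isOpen_iff_mem_nhds]
  rintro _ ⟨θ, hθ, rfl⟩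
  rw [← (hasStrictDerivAt_deriv_logPartition hθ).map_nhds_eq
    (deriv_deriv_logPartition_pos hρ hθ).ne']
  exact image_mem_map ((isOpen_paramSpace ρ).mem_nhds hθ)

lemma contDiffAt_natParam (hρ : Nondegenerate ρ) {m : ℝ} (hm : m ∈ meanSpace ρ) :
    ContDiffAt ℝ 1 (natParam ρ) m := by
  obtain ⟨θ, hθ, rfl⟩ := hm
  have hne := (deriv_deriv_logPartition_pos hρ hθ).ne'
  have hc : ContDiffAt ℝ 1 (deriv (logPartition ρ)) θ :=
    (analyticAt_logPartition hθ).deriv.contDiffAt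
  have hs := (hasStrictDerivAt_deriv_logPartition hθ).hasStrictFDerivAt_equiv hne
  refine (hc.to_localInverse hs.hasFDerivAt one_ne_zero).congr_of_eventuallyEq ?_
  refine HasStrictFDerivAt.localInverse_unique _ ?_
  filter_upwards [(isOpen_paramSpace ρ).mem_nhds hθ] with t ht
  exact natParam_deriv_logPartition hρ ht

lemma hasDerivAt_natParam (hρ : Nondegenerate ρ) {m : ℝ} (hm : m ∈ meanSpace ρ) :
    ∃ c, 0 < c ∧ HasDerivAt (natParam ρ) c m := by
  have hd := ((contDiffAt_natParam hρ hm).differentiableAt one_ne_zero).hasDerivAt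
  refine ⟨_, ?_, hd⟩
  have hb := (hasStrictDerivAt_deriv_logPartition (natParam_mem hm)).hasDerivAt
  have hcomp := HasDerivAt.comp m hb hd
  have hid : (deriv (logPartition ρ) ∘ natParam ρ) =ᶠ[𝓝 m] id := by
    filter_upwards [(isOpen_meanSpace hρ).mem_nhds hm] with t ht
    exact deriv_logPartition_natParam ht
  have h1 := (hcomp.congr_of_eventuallyEq hid.symm).unique (hasDerivAt_id m)
  have hp := deriv_deriv_logPartition_pos hρ (natParam_mem hm)
  exact pos_of_mul_pos_right (by rw [h1]; exact one_pos) hp.le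

/-! ### The Kullback-Leibler divergence -/

@[simp] lemma kl_self (ρ : Measure ℝ) (m : ℝ) : kl ρ m m = 0 := by simp [kl]

/-- The three-point identity of the divergence; it holds for all reals, without reference to `S`. -/
lemma kl_add (ρ : Measure ℝ) (p x y : ℝ) :
    kl ρ p y = kl ρ p x + kl ρ x y + (natParam ρ x - natParam ρ y) * (p - x) := by
  simp only [kl]; ring

/-- The divergence is the excess of the strictly convex function `b` over a tangent. -/
lemma kl_pos (hρ : Nondegenerate ρ) {p q : ℝ} (hp : p ∈ meanSpace ρ) (hq : q ∈ meanSpace ρ)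
    (hpq : p ≠ q) : 0 < kl ρ p q := by
  have hP := natParam_mem hp
  have hQ := natParam_mem hq
  have hconv : StrictConvexOn ℝ (paramSpace ρ) (logPartition ρ) := by
    refine StrictMonoOn.strictConvexOn_of_deriv (convex_paramSpace ρ) ?_ ?_
    · exact fun θ hθ => (analyticAt_logPartition hθ).continuousAt.continuousWithinAt
    · rw [(isOpen_paramSpace ρ).interior_eq]
      exact strictMonoOn_deriv_logPartition hρ
  have hdiff := (analyticAt_logPartition hP).differentiableAt
  have hd := deriv_logPartition_natParam hp
  rcases lt_or_gt_of_ne hpq with h | h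
  · have hlt := strictMonoOn_natParam hρ hp hq h
    have := hconv.deriv_lt_slope hP hQ hlt hdiff
    rw [hd, slope_def_field, lt_div_iff₀ (sub_pos.2 hlt)] at this
    simp only [kl]; linarith
  · have hlt := strictMonoOn_natParam hρ hq hp h
    have := hconv.slope_lt_deriv hQ hP hlt hdiff
    rw [hd, slope_def_field, div_lt_iff₀ (sub_pos.2 hlt)] at this
    simp only [kl]; linarith

lemma kl_nonneg (hρ : Nondegenerate ρ) {p q : ℝ} (hp : p ∈ meanSpace ρ) (hq : q ∈ meanSpace ρ) :
    0 ≤ kl ρ p q := by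
  rcases eq_or_ne p q with rfl | h
  · simp
  · exact (kl_pos hρ hp hq h).le

/-- The divergence from `p` increases as its second argument moves away from `p` to the left. -/
lemma kl_lt_kl_of_lt_of_le (hρ : Nondegenerate ρ) {p x y : ℝ} (hp : p ∈ meanSpace ρ)
    (hy : y ∈ meanSpace ρ) (hyx : y < x) (hxp : x ≤ p) : kl ρ p x < kl ρ p y := by
  have hx : x ∈ meanSpace ρ := (ordConnected_meanSpace ρ).out hy hp ⟨hyx.le, hxp⟩
  have h1 := kl_pos hρ hx hy hyx.ne'
  have h2 := strictMonoOn_natParam hρ hy hx hyx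
  rw [kl_add ρ p x y]
  nlinarith [mul_nonneg (sub_nonneg.2 h2.le) (sub_nonneg.2 hxp)]

/-- The divergence from `q` increases as its second argument moves away from `q` to the right. -/
lemma kl_lt_kl_of_le_of_lt (hρ : Nondegenerate ρ) {q x y : ℝ} (hq : q ∈ meanSpace ρ)
    (hy : y ∈ meanSpace ρ) (hqx : q ≤ x) (hxy : x < y) : kl ρ q x < kl ρ q y := by
  have hx : x ∈ meanSpace ρ := (ordConnected_meanSpace ρ).out hq hy ⟨hqx, hxy.le⟩
  have h1 := kl_pos hρ hx hy hxy.ne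
  have h2 := strictMonoOn_natParam hρ hx hy hxy
  rw [kl_add ρ q x y]
  nlinarith [mul_nonneg (sub_nonneg.2 h2.le) (sub_nonneg.2 hqx)]

lemma hasDerivAt_kl_right (p : ℝ) {y : ℝ} (hy : y ∈ meanSpace ρ) {c : ℝ}
    (hc : HasDerivAt (natParam ρ) c y) : HasDerivAt (kl ρ p) (c * (y - p)) y := by
  have hb : HasDerivAt (logPartition ρ) y (natParam ρ y) := by
    have := (analyticAt_logPartition (natParam_mem hy)).differentiableAt.hasDerivAt
    rwa [deriv_logPartition_natParam hy] at this
  have h := ((((hasDerivAt_const y (natParam ρ p)).sub hc).mul_const p).sub_const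
    (logPartition ρ (natParam ρ p))).add (hb.comp y hc)
  exact h.congr_deriv (by ring)

lemma contDiffAt_logPartition_natParam (hρ : Nondegenerate ρ) {m : ℝ} (hm : m ∈ meanSpace ρ) :
    ContDiffAt ℝ 1 (fun x => logPartition ρ (natParam ρ x)) m :=
  (analyticAt_logPartition (natParam_mem hm)).contDiffAt.comp m (contDiffAt_natParam hρ hm)

lemma contDiffAt_kl (hρ : Nondegenerate ρ) {E : Type*} [NormedAddCommGroup E] [NormedSpace ℝ E]
    {f g : E → ℝ} {z : E} (hf : ContDiffAt ℝ 1 f z) (hg : ContDiffAt ℝ 1 g z)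
    (hfz : f z ∈ meanSpace ρ) (hgz : g z ∈ meanSpace ρ) :
    ContDiffAt ℝ 1 (fun w => kl ρ (f w) (g w)) z := by
  have h1 := (contDiffAt_natParam hρ hfz).comp z hf
  have h2 := (contDiffAt_natParam hρ hgz).comp z hg
  have h3 := (contDiffAt_logPartition_natParam hρ hfz).comp z hf
  have h4 := (contDiffAt_logPartition_natParam hρ hgz).comp z hg
  exact (((h1.sub h2).mul hf).sub h3).add h4

/-! ### Exponential moments of the arms -/

/-- The centred law of an arm is sub-Gaussian for small parameters: its cumulant generating function
is `O(t ^ 2)` at the origin. -/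
lemma exists_lintegral_exp_armLaw_le (hρ : Nondegenerate ρ) {m : ℝ} (hm : m ∈ meanSpace ρ) :
    ∃ C, 0 < C ∧ ∀ᶠ t in 𝓝 (0 : ℝ),
      ∫⁻ x, ENNReal.ofReal (Real.exp (t * (x - m))) ∂(armLaw ρ m)
        ≤ ENNReal.ofReal (Real.exp (C * t ^ 2)) := by
  set θ := natParam ρ m with hθdef
  have hθ : θ ∈ paramSpace ρ := natParam_mem hm
  have han := analyticAt_logPartition hθ
  obtain ⟨pw, hpw⟩ := han
  have hbig := hpw.isBigO_sub_partialSum_pow 2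
  have hb : HasDerivAt (logPartition ρ) m θ := by
    have := (analyticAt_logPartition hθ).differentiableAt.hasDerivAt
    rwa [deriv_logPartition_natParam hm] at this
  have hsum : ∀ y, pw.partialSum 2 y = logPartition ρ θ + y * m := by
    intro y
    have h1 : pw.coeff 1 = m := hpw.deriv.symm.trans hb.deriv
    have h0 : pw.coeff 0 = logPartition ρ θ := hpw.coeff_zero _
    simp [FormalMultilinearSeries.partialSum, Finset.sum_range_succ,
      h1, h0]
  obtain ⟨C, hC0, hC⟩ := hbig.exists_pos
  refine ⟨C, hC0, ?_⟩
  have hmem : ∀ᶠ t in 𝓝 (0 : ℝ), θ + t ∈ paramSpace ρ := by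
    have : Tendsto (fun t : ℝ => θ + t) (𝓝 0) (𝓝 θ) := by
      simpa using (tendsto_const_nhds (x := θ)).add (tendsto_id (α := ℝ) (x := 𝓝 0))
    exact this ((isOpen_paramSpace ρ).mem_nhds hθ)
  filter_upwards [hC.bound, hmem] with t ht hmt
  rw [hsum] at ht
  have hle : logPartition ρ (θ + t) - logPartition ρ θ - t * m ≤ C * t ^ 2 := by
    have := (le_abs_self _).trans ht
    simp only [norm_pow, Real.norm_eq_abs, sq_abs] at this
    linarith
  have hpos : ∀ s ∈ paramSpace ρ, 0 < mgf id ρ s := fun s hs =>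
    mgf_pos' hρ.ne_zero (integrable_exp_of_mem_paramSpace hs)
  have hexp : ∀ s ∈ paramSpace ρ, mgf id ρ s = Real.exp (logPartition ρ s) := fun s hs =>
    (Real.exp_log (hpos s hs)).symm
  rw [armLaw, lintegral_tilted]
  have heq : ∀ x : ℝ, ENNReal.ofReal (Real.exp (θ * x) / ∫ x, Real.exp (θ * x) ∂ρ)
      * ENNReal.ofReal (Real.exp (t * (x - m)))
      = ENNReal.ofReal (Real.exp (-(t * m) - logPartition ρ θ) * Real.exp ((θ + t) * x)) := by
    intro x
    have : ∫ x, Real.exp (θ * x) ∂ρ = Real.exp (logPartition ρ θ) := hexp θ hθ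
    rw [this, ← ENNReal.ofReal_mul (by positivity), ← Real.exp_sub, ← Real.exp_add, ← Real.exp_add]
    congr 2
    ring
  simp_rw [← hθdef, heq]
  have hint : Integrable (fun x : ℝ => Real.exp ((θ + t) * x)) ρ :=
    integrable_exp_of_mem_paramSpace hmt
  rw [← ofReal_integral_eq_lintegral_ofReal (hint.const_mul _)
    (Eventually.of_forall fun x => by positivity), integral_const_mul]
  have : ∫ x, Real.exp ((θ + t) * x) ∂ρ = Real.exp (logPartition ρ (θ + t)) := hexp _ hmt
  rw [this, ← Real.exp_add]
  refine ENNReal.ofReal_le_ofReal (Real.exp_le_exp.2 ?_)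
  linarith

end ExponentialFamily

/-! ### The anchor terms and the indexes as functions of the ratio of the pulls -/

section Ratio

/-- The weighted average of `p` and `q` when `q` carries `r` times the weight of `p`. -/
noncomputable def mix (p q r : ℝ) : ℝ := (p + r * q) / (1 + r)

/-- A summand of the anchor function, as a function of the ratio `r` between the number of pulls of
the challenger (mean `q`) and of the leader (mean `p`). -/
noncomputable def klRatio (ρ : Measure ℝ) (p q r : ℝ) : ℝ := kl ρ p (mix p q r) / kl ρ q (mix p q r)

/-- The index of a challenger (mean `q`) divided by the number of pulls of the leader (mean `p`), as
a function of the ratio `r` of their numbers of pulls. -/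
noncomputable def scaledIndex (ρ : Measure ℝ) (p q r : ℝ) : ℝ :=
  kl ρ p (mix p q r) + r * kl ρ q (mix p q r)

variable {ρ : Measure ℝ} {p q r : ℝ}

lemma mix_eq (hr : 0 ≤ r) : mix p q r = q + (p - q) / (1 + r) := by
  have : (1 + r) ≠ 0 := by positivity
  rw [mix]; field_simp; ring

lemma mix_sub (hr : 0 ≤ r) : p - mix p q r = r * (mix p q r - q) := by
  have : (1 + r) ≠ 0 := by positivity
  rw [mix]; field_simp; ring

lemma mix_zero : mix p q 0 = p := by simp [mix]

lemma lt_mix (hqp : q < p) (hr : 0 ≤ r) : q < mix p q r := by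
  rw [mix_eq hr]
  have : 0 < (p - q) / (1 + r) := div_pos (sub_pos.2 hqp) (by positivity)
  linarith

lemma mix_le (hqp : q < p) (hr : 0 ≤ r) : mix p q r ≤ p := by
  have := mul_nonneg hr (sub_nonneg.2 (lt_mix hqp hr).le)
  rw [← mix_sub hr] at this
  linarith

lemma mix_lt (hqp : q < p) (hr : 0 < r) : mix p q r < p := by
  have := mul_pos hr (sub_pos.2 (lt_mix hqp hr.le))
  rw [← mix_sub hr.le] at this
  linarith

lemma strictAntiOn_mix (hqp : q < p) : StrictAntiOn (mix p q) (Ici 0) := by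
  intro r hr r' hr' h
  have h0 : (0 : ℝ) < 1 + r := by have : (0 : ℝ) ≤ r := hr; linarith
  rw [mix_eq hr, mix_eq hr']
  gcongr

lemma mix_mem (hp : p ∈ meanSpace ρ) (hq : q ∈ meanSpace ρ) (hqp : q < p) (hr : 0 ≤ r) :
    mix p q r ∈ meanSpace ρ :=
  (ordConnected_meanSpace ρ).out hq hp ⟨(lt_mix hqp hr).le, mix_le hqp hr⟩

lemma tendsto_mix (p q : ℝ) : Tendsto (mix p q) atTop (𝓝 q) := by
  have h : Tendsto (fun r : ℝ => q + (p - q) / (1 + r)) atTop (𝓝 (q + 0)) :=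
    tendsto_const_nhds.add (Tendsto.div_atTop tendsto_const_nhds
      (tendsto_atTop_add_const_left _ _ tendsto_id))
  rw [add_zero] at h
  refine h.congr' ?_
  filter_upwards [eventually_ge_atTop 0] with r hr
  rw [mix_eq hr]

lemma klRatio_zero : klRatio ρ p q 0 = 0 := by simp [klRatio, mix_zero]

lemma scaledIndex_zero : scaledIndex ρ p q 0 = 0 := by simp [scaledIndex, mix_zero]

lemma kl_mix_right_pos (hρ : Nondegenerate ρ) (hp : p ∈ meanSpace ρ) (hq : q ∈ meanSpace ρ)
    (hqp : q < p) (hr : 0 ≤ r) : 0 < kl ρ q (mix p q r) :=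
  kl_pos hρ hq (mix_mem hp hq hqp hr) (lt_mix hqp hr).ne

lemma klRatio_nonneg (hρ : Nondegenerate ρ) (hp : p ∈ meanSpace ρ) (hq : q ∈ meanSpace ρ)
    (hqp : q < p) (hr : 0 ≤ r) : 0 ≤ klRatio ρ p q r :=
  div_nonneg (kl_nonneg hρ hp (mix_mem hp hq hqp hr)) (kl_mix_right_pos hρ hp hq hqp hr).le

lemma strictMonoOn_klRatio (hρ : Nondegenerate ρ) (hp : p ∈ meanSpace ρ) (hq : q ∈ meanSpace ρ)
    (hqp : q < p) : StrictMonoOn (klRatio ρ p q) (Ici 0) := by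
  intro r hr r' hr' h
  have hlt := strictAntiOn_mix hqp hr hr' h
  refine div_lt_div₀ (kl_lt_kl_of_lt_of_le hρ hp (mix_mem hp hq hqp hr') hlt (mix_le hqp hr))
    (kl_lt_kl_of_le_of_lt hρ hq (mix_mem hp hq hqp hr) (lt_mix hqp hr').le hlt).le
    (kl_nonneg hρ hp (mix_mem hp hq hqp hr')) (kl_mix_right_pos hρ hp hq hqp hr')

/-- The weighted average minimises the weighted sum of the divergences, with an explicit excess. -/
lemma kl_add_mul_kl (hr : 0 ≤ r) (y : ℝ) :
    kl ρ p y + r * kl ρ q y = scaledIndex ρ p q r + (1 + r) * kl ρ (mix p q r) y := by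
  have h := mix_sub (p := p) (q := q) hr
  rw [scaledIndex, kl_add ρ p (mix p q r) y, kl_add ρ q (mix p q r) y]
  linear_combination (natParam ρ (mix p q r) - natParam ρ y) * h

lemma strictMonoOn_scaledIndex (hρ : Nondegenerate ρ) (hp : p ∈ meanSpace ρ)
    (hq : q ∈ meanSpace ρ) (hqp : q < p) : StrictMonoOn (scaledIndex ρ p q) (Ici 0) := by
  intro r hr r' hr' h
  have h1 := kl_add_mul_kl (ρ := ρ) (p := p) (q := q) hr (mix p q r')
  have h2 := mul_nonneg (by have : (0 : ℝ) ≤ r := hr; linarith : (0 : ℝ) ≤ 1 + r)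
    (kl_nonneg hρ (mix_mem hp hq hqp hr) (mix_mem hp hq hqp hr'))
  have h3 := mul_pos (sub_pos.2 h) (kl_mix_right_pos hρ hp hq hqp hr')
  have h4 : scaledIndex ρ p q r' = kl ρ p (mix p q r') + r' * kl ρ q (mix p q r') := rfl
  linarith

lemma scaledIndex_lt (hρ : Nondegenerate ρ) (hp : p ∈ meanSpace ρ) (hq : q ∈ meanSpace ρ)
    (hqp : q < p) (hr : 0 ≤ r) : scaledIndex ρ p q r < kl ρ p q := by
  have h1 := kl_add_mul_kl (ρ := ρ) (p := p) (q := q) hr q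
  have h2 := mul_pos (by linarith : (0 : ℝ) < 1 + r)
    (kl_pos hρ (mix_mem hp hq hqp hr) hq (lt_mix hqp hr).ne')
  rw [kl_self] at h1
  linarith

lemma continuousAt_kl_right (hρ : Nondegenerate ρ) (p : ℝ) {y : ℝ} (hy : y ∈ meanSpace ρ) :
    ContinuousAt (kl ρ p) y := by
  obtain ⟨c, -, hc⟩ := hasDerivAt_natParam hρ hy
  exact (hasDerivAt_kl_right p hy hc).continuousAt

lemma exists_le_klRatio (hρ : Nondegenerate ρ) (hp : p ∈ meanSpace ρ) (hq : q ∈ meanSpace ρ)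
    (hqp : q < p) (M : ℝ) : ∃ r, 0 < r ∧ M ≤ klRatio ρ p q r := by
  have h1 : Tendsto (fun r => kl ρ p (mix p q r)) atTop (𝓝 (kl ρ p q)) :=
    (continuousAt_kl_right hρ p hq).tendsto.comp (tendsto_mix p q)
  have h2 : Tendsto (fun r => kl ρ q (mix p q r)) atTop (𝓝[>] 0) := by
    refine tendsto_nhdsWithin_iff.2 ⟨?_, ?_⟩
    · have := (continuousAt_kl_right hρ q hq).tendsto.comp (tendsto_mix p q)
      rwa [kl_self] at this
    · filter_upwards [eventually_ge_atTop 0] with r hr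
      exact kl_mix_right_pos hρ hp hq hqp hr
  have h3 : Tendsto (klRatio ρ p q) atTop atTop :=
    h1.pos_mul_atTop (kl_pos hρ hp hq hqp.ne') (tendsto_inv_nhdsGT_zero.comp h2)
  obtain ⟨r, h, hr⟩ := ((h3.eventually_ge_atTop M).and (eventually_gt_atTop 0)).exists
  exact ⟨r, hr, h⟩

lemma exists_le_scaledIndex (hρ : Nondegenerate ρ) (hp : p ∈ meanSpace ρ) (hq : q ∈ meanSpace ρ)
    (hqp : q < p) {w : ℝ} (hw : w < kl ρ p q) : ∃ r, 0 ≤ r ∧ w ≤ scaledIndex ρ p q r := by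
  have h1 : Tendsto (fun r => kl ρ p (mix p q r)) atTop (𝓝 (kl ρ p q)) :=
    (continuousAt_kl_right hρ p hq).tendsto.comp (tendsto_mix p q)
  obtain ⟨r, h, hr⟩ := ((h1.eventually_const_le hw).and (eventually_ge_atTop 0)).exists
  have := mul_nonneg hr (kl_mix_right_pos hρ hp hq hqp hr).le
  exact ⟨r, hr, by rw [scaledIndex]; linarith⟩

lemma contDiffAt_mix (hr : 0 ≤ r) :
    ContDiffAt ℝ 1 (fun z : ℝ × ℝ × ℝ => mix z.1 z.2.1 z.2.2) (p, q, r) := by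
  have : (1 + r) ≠ 0 := by positivity
  refine ContDiffAt.div (by fun_prop) (by fun_prop) this

lemma contDiffAt_klRatio (hρ : Nondegenerate ρ) (hp : p ∈ meanSpace ρ) (hq : q ∈ meanSpace ρ)
    (hqp : q < p) (hr : 0 ≤ r) :
    ContDiffAt ℝ 1 (fun z : ℝ × ℝ × ℝ => klRatio ρ z.1 z.2.1 z.2.2) (p, q, r) := by
  have hm := mix_mem hp hq hqp hr
  refine ContDiffAt.div (contDiffAt_kl hρ (by fun_prop) (contDiffAt_mix hr) hp hm)
    (contDiffAt_kl hρ (by fun_prop) (contDiffAt_mix hr) hq hm)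
    (kl_mix_right_pos hρ hp hq hqp hr).ne'

lemma continuousOn_klRatio (hρ : Nondegenerate ρ) (hp : p ∈ meanSpace ρ) (hq : q ∈ meanSpace ρ)
    (hqp : q < p) : ContinuousOn (klRatio ρ p q) (Ici 0) := fun r hr =>
  (ContinuousAt.comp (g := fun z : ℝ × ℝ × ℝ => klRatio ρ z.1 z.2.1 z.2.2)
    (f := fun r : ℝ => (p, q, r)) (contDiffAt_klRatio hρ hp hq hqp hr).continuousAt
    (by fun_prop)).continuousWithinAt

lemma contDiffAt_scaledIndex (hρ : Nondegenerate ρ) (hp : p ∈ meanSpace ρ) (hq : q ∈ meanSpace ρ)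
    (hqp : q < p) (hr : 0 ≤ r) :
    ContDiffAt ℝ 1 (fun z : ℝ × ℝ × ℝ => scaledIndex ρ z.1 z.2.1 z.2.2) (p, q, r) := by
  have hm := mix_mem hp hq hqp hr
  refine ContDiffAt.add (contDiffAt_kl hρ (by fun_prop) (contDiffAt_mix hr) hp hm)
    (ContDiffAt.mul (by fun_prop) (contDiffAt_kl hρ (by fun_prop) (contDiffAt_mix hr) hq hm))

lemma continuousOn_scaledIndex (hρ : Nondegenerate ρ) (hp : p ∈ meanSpace ρ)
    (hq : q ∈ meanSpace ρ) (hqp : q < p) : ContinuousOn (scaledIndex ρ p q) (Ici 0) := fun r hr =>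
  (ContinuousAt.comp (g := fun z : ℝ × ℝ × ℝ => scaledIndex ρ z.1 z.2.1 z.2.2)
    (f := fun r : ℝ => (p, q, r)) (contDiffAt_scaledIndex hρ hp hq hqp hr).continuousAt
    (by fun_prop)).continuousWithinAt

lemma hasDerivAt_mix (hr : 0 ≤ r) : HasDerivAt (mix p q) (-((p - q) / (1 + r) ^ 2)) r := by
  have h0 : (1 + r) ≠ 0 := by positivity
  have h := (((hasDerivAt_id r).mul_const q).const_add p).div ((hasDerivAt_id r).const_add 1) h0
  refine h.congr_deriv ?_
  simp only [id]
  field_simp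
  ring

lemma exists_hasDerivAt_klRatio (hρ : Nondegenerate ρ) (hp : p ∈ meanSpace ρ)
    (hq : q ∈ meanSpace ρ) (hqp : q < p) (hr : 0 < r) :
    ∃ D, 0 < D ∧ HasDerivAt (klRatio ρ p q) D r := by
  have hm := mix_mem hp hq hqp hr.le
  obtain ⟨c, hc, hθ⟩ := hasDerivAt_natParam hρ hm
  have hx : HasDerivAt (mix p q) (-((p - q) / (1 + r) ^ 2)) r := hasDerivAt_mix hr.le
  have h1 := (hasDerivAt_kl_right p hm hθ).comp r hx
  have h2 := (hasDerivAt_kl_right q hm hθ).comp r hx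
  have hden := kl_mix_right_pos hρ hp hq hqp hr.le
  refine ⟨_, ?_, h1.div h2 hden.ne'⟩
  have hs : 0 < (p - q) / (1 + r) ^ 2 := div_pos (sub_pos.2 hqp) (by positivity)
  set s := (p - q) / (1 + r) ^ 2
  refine div_pos ?_ (pow_pos hden 2)
  have e1 : 0 < c * (p - mix p q r) * s :=
    mul_pos (mul_pos hc (sub_pos.2 (mix_lt hqp hr))) hs
  have e2 : 0 < c * (mix p q r - q) * s :=
    mul_pos (mul_pos hc (sub_pos.2 (lt_mix hqp hr.le))) hs
  have hnum := kl_nonneg hρ hp hm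
  simp only [Function.comp]
  have := mul_pos e1 hden
  have := mul_nonneg hnum e2.le
  nlinarith

lemma exists_hasDerivAt_scaledIndex (hρ : Nondegenerate ρ) (hp : p ∈ meanSpace ρ)
    (hq : q ∈ meanSpace ρ) (hqp : q < p) (hr : 0 < r) :
    ∃ D, 0 < D ∧ HasDerivAt (scaledIndex ρ p q) D r := by
  have hm := mix_mem hp hq hqp hr.le
  obtain ⟨c, hc, hθ⟩ := hasDerivAt_natParam hρ hm
  have hx : HasDerivAt (mix p q) (-((p - q) / (1 + r) ^ 2)) r := hasDerivAt_mix hr.le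
  have h1 := (hasDerivAt_kl_right p hm hθ).comp r hx
  have h2 := (hasDerivAt_kl_right q hm hθ).comp r hx
  refine ⟨kl ρ q (mix p q r), kl_mix_right_pos hρ hp hq hqp hr.le,
    (h1.add ((hasDerivAt_id r).mul h2)).congr_deriv ?_⟩
  have h := mix_sub (p := p) (q := q) hr.le
  simp only [Function.comp, id]
  linear_combination (c * ((p - q) / (1 + r) ^ 2)) * h

/-! ### Sensitivity of a monotone function to perturbations of its parameters -/

section Sensitivity

variable {f : ℝ → ℝ → ℝ → ℝ} {r₀ : ℝ}

/-- `f` is regular at `(p, q, r₀)`: continuously differentiable there, with a positive derivative in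
the last variable, and nondecreasing on `[0, ∞)` in the last variable for all nearby values of the
first two. -/
structure IsRegular (f : ℝ → ℝ → ℝ → ℝ) (p q r₀ : ℝ) : Prop where
  pos : 0 < r₀
  contDiffAt : ContDiffAt ℝ 1 (fun z : ℝ × ℝ × ℝ => f z.1 z.2.1 z.2.2) (p, q, r₀)
  deriv : ∃ D, 0 < D ∧ HasDerivAt (f p q) D r₀
  mono : ∀ᶠ z : ℝ × ℝ in 𝓝 (p, q), MonotoneOn (f z.1 z.2) (Ici 0)

/-- Two-sided linear bounds for a regular function, on a window around `r₀` of width proportional to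
the size `δ` of the perturbation of the parameters. -/
lemma IsRegular.exists_bounds (hf : IsRegular f p q r₀) :
    ∃ D > 0, ∃ L ≥ 0, ∀ B ≥ 0, ∀ᶠ δ in 𝓝[>] (0 : ℝ), ∀ p' q', |p' - p| ≤ δ → |q' - q| ≤ δ →
      MonotoneOn (f p' q') (Ici 0) ∧ ∀ u, |u| ≤ B * δ → 0 ≤ r₀ + u ∧
        f p q r₀ + D * u - D / 2 * |u| - L * δ ≤ f p' q' (r₀ + u) ∧
        f p' q' (r₀ + u) ≤ f p q r₀ + D * u + D / 2 * |u| + L * δ := by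
  obtain ⟨hr0, hc, ⟨D, hD, hder⟩, hmono⟩ := hf
  obtain ⟨L, s, hs, hL⟩ := hc.exists_lipschitzOnWith
  obtain ⟨η₁, hη₁, hball⟩ := Metric.mem_nhds_iff.1 hs
  obtain ⟨η₂, hη₂, hmono'⟩ := Metric.eventually_nhds_iff.1 hmono
  have hlin := (hasDerivAt_iff_isLittleO_nhds_zero.1 hder).bound (half_pos hD)
  obtain ⟨η₃, hη₃, hlin'⟩ := Metric.eventually_nhds_iff.1 hlin
  refine ⟨D, hD, L, L.2, fun B hB => ?_⟩
  have hsmall : ∀ η > (0 : ℝ), ∀ A : ℝ, ∀ᶠ δ in 𝓝[>] (0 : ℝ), A * δ < η := by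
    intro η hη A
    have : Tendsto (fun δ : ℝ => A * δ) (𝓝[>] 0) (𝓝 0) := by
      have := (continuous_const_mul A).tendsto 0
      rw [mul_zero] at this
      exact this.mono_left nhdsWithin_le_nhds
    exact this.eventually_lt_const hη
  filter_upwards [hsmall η₁ hη₁ 1, hsmall η₁ hη₁ B, hsmall η₂ hη₂ 1, hsmall η₃ hη₃ B,
    hsmall r₀ hr0 B, self_mem_nhdsWithin] with δ h1 h2 h3 h4 h5 hδ p' q' hp' hq'
  rw [one_mul] at h1 h3
  have hδ' : (0 : ℝ) < δ := hδ
  refine ⟨hmono' (y := (p', q')) ?_, fun u hu => ?_⟩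
  · rw [Prod.dist_eq, max_lt_iff, Real.dist_eq, Real.dist_eq]
    exact ⟨hp'.trans_lt h3, hq'.trans_lt h3⟩
  have hin1 : ((p', q', r₀ + u) : ℝ × ℝ × ℝ) ∈ s := by
    refine hball ?_
    rw [Metric.mem_ball, Prod.dist_eq, Prod.dist_eq, max_lt_iff, max_lt_iff, Real.dist_eq,
      Real.dist_eq, Real.dist_eq, add_sub_cancel_left]
    exact ⟨hp'.trans_lt h1, hq'.trans_lt h1, hu.trans_lt h2⟩
  have hin2 : ((p, q, r₀ + u) : ℝ × ℝ × ℝ) ∈ s := by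
    refine hball ?_
    rw [Metric.mem_ball, Prod.dist_eq, Prod.dist_eq, max_lt_iff, max_lt_iff, Real.dist_eq,
      Real.dist_eq, Real.dist_eq, add_sub_cancel_left]
    exact ⟨by simpa using hη₁, by simpa using hη₁, hu.trans_lt h2⟩
  have hlip := hL.dist_le_mul _ hin1 _ hin2
  have hdist : dist ((p', q', r₀ + u) : ℝ × ℝ × ℝ) (p, q, r₀ + u) ≤ δ := by
    rw [Prod.dist_eq, Prod.dist_eq, dist_self, max_le_iff, max_le_iff, Real.dist_eq, Real.dist_eq]
    exact ⟨hp', hq', hδ'.le⟩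
  have hlip' := hlip.trans (mul_le_mul_of_nonneg_left hdist L.2)
  rw [Real.dist_eq, abs_le] at hlip'
  have hl := hlin' (y := u) (by rw [Real.dist_eq, sub_zero]; exact hu.trans_lt h4)
  rw [Real.norm_eq_abs, Real.norm_eq_abs, abs_le, smul_eq_mul] at hl
  have hu' := (abs_le.1 (hu.trans h5.le)).1
  refine ⟨by linarith, ?_, ?_⟩ <;> simp only at hlip' <;> linarith [hlip'.1, hlip'.2, hl.1, hl.2]

/-- As `f` is nondecreasing in the last variable, a bound on its value forces a bound on the variable
itself, also far from `r₀`. -/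
lemma IsRegular.le_of_apply_le (hf : IsRegular f p q r₀) (A : ℝ) :
    ∀ᶠ C in atTop, ∀ᶠ δ in 𝓝[>] (0 : ℝ), ∀ p' q', |p' - p| ≤ δ → |q' - q| ≤ δ → ∀ r, 0 ≤ r →
      f p' q' r ≤ f p q r₀ + A * δ → r ≤ r₀ + C * δ := by
  obtain ⟨D, hD, L, hL, h⟩ := hf.exists_bounds
  filter_upwards [eventually_gt_atTop (2 * (A + L) / D), eventually_ge_atTop 0] with C hC hC0
  rw [div_lt_iff₀ hD] at hC
  filter_upwards [h C hC0, self_mem_nhdsWithin] with δ hδ hδ0 p' q' hp' hq' r hr hle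
  have hδ0 : 0 < δ := hδ0
  obtain ⟨hm, hu⟩ := hδ p' q' hp' hq'
  have hCδ : 0 ≤ C * δ := by positivity
  -- At `r₀ + C * δ` the growth `D / 2 * (C * δ)` already exceeds the perturbation `(A + L) * δ`.
  obtain ⟨h1, h2, -⟩ := hu (C * δ) (abs_of_nonneg hCδ).le
  rw [abs_of_nonneg hCδ] at h2
  by_contra! hlt
  have h3 := hm h1 hr hlt.le
  nlinarith

lemma IsRegular.le_of_le_apply (hf : IsRegular f p q r₀) (A : ℝ) :
    ∀ᶠ C in atTop, ∀ᶠ δ in 𝓝[>] (0 : ℝ), ∀ p' q', |p' - p| ≤ δ → |q' - q| ≤ δ → ∀ r, 0 ≤ r →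
      f p q r₀ - A * δ ≤ f p' q' r → r₀ - C * δ ≤ r := by
  obtain ⟨D, hD, L, hL, h⟩ := hf.exists_bounds
  filter_upwards [eventually_gt_atTop (2 * (A + L) / D), eventually_ge_atTop 0] with C hC hC0
  rw [div_lt_iff₀ hD] at hC
  filter_upwards [h C hC0, self_mem_nhdsWithin] with δ hδ hδ0 p' q' hp' hq' r hr hle
  have hδ0 : 0 < δ := hδ0
  obtain ⟨hm, hu⟩ := hδ p' q' hp' hq'
  have hCδ : 0 ≤ C * δ := by positivity
  obtain ⟨h1, -, h2⟩ := hu (-(C * δ)) (by rw [abs_neg, abs_of_nonneg hCδ])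
  rw [abs_neg, abs_of_nonneg hCδ] at h2
  by_contra! hlt
  have h3 := hm hr h1 (by linarith)
  nlinarith

lemma IsRegular.apply_le_of_le (hf : IsRegular f p q r₀) {A : ℝ} (hA : 0 ≤ A) :
    ∀ᶠ C in atTop, ∀ᶠ δ in 𝓝[>] (0 : ℝ), ∀ p' q', |p' - p| ≤ δ → |q' - q| ≤ δ → ∀ r, 0 ≤ r →
      r ≤ r₀ + A * δ → f p' q' r ≤ f p q r₀ + C * δ := by
  obtain ⟨D, hD, L, hL, h⟩ := hf.exists_bounds
  filter_upwards [eventually_ge_atTop (2 * (D * A) + L)] with C hC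
  filter_upwards [h A hA, self_mem_nhdsWithin] with δ hδ hδ0 p' q' hp' hq' r hr hle
  have hδ0 : 0 < δ := hδ0
  obtain ⟨hm, hu⟩ := hδ p' q' hp' hq'
  have hAδ : 0 ≤ A * δ := by positivity
  obtain ⟨h1, -, h2⟩ := hu (A * δ) (abs_of_nonneg hAδ).le
  rw [abs_of_nonneg hAδ] at h2
  have h3 := hm hr h1 hle
  have h4 : 0 ≤ D * (A * δ) := by positivity
  nlinarith

end Sensitivity

lemma eventually_mem_meanSpace_and_lt (hρ : Nondegenerate ρ) (hp : p ∈ meanSpace ρ)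
    (hq : q ∈ meanSpace ρ) (hqp : q < p) :
    ∀ᶠ z : ℝ × ℝ in 𝓝 (p, q), z.1 ∈ meanSpace ρ ∧ z.2 ∈ meanSpace ρ ∧ z.2 < z.1 := by
  have h1 : ∀ᶠ z : ℝ × ℝ in 𝓝 (p, q), z.1 ∈ meanSpace ρ :=
    continuousAt_fst.eventually ((isOpen_meanSpace hρ).mem_nhds hp)
  have h2 : ∀ᶠ z : ℝ × ℝ in 𝓝 (p, q), z.2 ∈ meanSpace ρ :=
    continuousAt_snd.eventually ((isOpen_meanSpace hρ).mem_nhds hq)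
  have h3 : ∀ᶠ z : ℝ × ℝ in 𝓝 (p, q), z.2 < z.1 :=
    continuousAt_snd.eventually_lt continuousAt_fst hqp
  exact h1.and (h2.and h3)

lemma isRegular_klRatio (hρ : Nondegenerate ρ) (hp : p ∈ meanSpace ρ) (hq : q ∈ meanSpace ρ)
    (hqp : q < p) (hr : 0 < r) : IsRegular (klRatio ρ) p q r where
  pos := hr
  contDiffAt := contDiffAt_klRatio hρ hp hq hqp hr.le
  deriv := exists_hasDerivAt_klRatio hρ hp hq hqp hr
  mono := (eventually_mem_meanSpace_and_lt hρ hp hq hqp).mono fun _ hz =>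
    (strictMonoOn_klRatio hρ hz.1 hz.2.1 hz.2.2).monotoneOn

lemma isRegular_scaledIndex (hρ : Nondegenerate ρ) (hp : p ∈ meanSpace ρ) (hq : q ∈ meanSpace ρ)
    (hqp : q < p) (hr : 0 < r) : IsRegular (scaledIndex ρ) p q r where
  pos := hr
  contDiffAt := contDiffAt_scaledIndex hρ hp hq hqp hr.le
  deriv := exists_hasDerivAt_scaledIndex hρ hp hq hqp hr
  mono := (eventually_mem_meanSpace_and_lt hρ hp hq hqp).mono fun _ hz =>
    (strictMonoOn_scaledIndex hρ hz.1 hz.2.1 hz.2.2).monotoneOn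

end Ratio

/-! ### The optimal allocation -/

section Optimal

/-- A continuous strictly increasing function on `[0, ∞)` vanishing at `0` has a continuous inverse
on `[0, f R]`. -/
lemma exists_continuousOn_rightInverse {f : ℝ → ℝ} (hf : StrictMonoOn f (Ici 0))
    (hc : ContinuousOn f (Ici 0)) (h0 : f 0 = 0) {R : ℝ} (hR : 0 ≤ R) :
    ∃ g : ℝ → ℝ, ContinuousOn g (Icc 0 (f R)) ∧ ∀ w ∈ Icc 0 (f R), 0 ≤ g w ∧ f (g w) = w := by
  -- Extend `f` from `[0, R]` to an increasing homeomorphism of the line, with slope `1` outside.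
  set π : ℝ → ℝ := fun x => max 0 (min x R) with hπ
  have hπ0 : ∀ x, 0 ≤ π x := fun x => le_max_left _ _
  have hπR : ∀ x, π x ≤ R := fun x => max_le hR (min_le_right _ _)
  have hπc : Continuous π := by fun_prop
  have hπid : ∀ x, 0 ≤ x → x ≤ R → π x = x := fun x h1 h2 => by simp [hπ, h1, h2]
  have hπlip : ∀ x y, x ≤ y → π x ≤ π y ∧ x - π x ≤ y - π y := by
    intro x y hxy
    refine ⟨max_le_max le_rfl (min_le_min hxy le_rfl), ?_⟩
    simp only [hπ]
    rcases le_total x R with h1 | h1 <;> rcases le_total y R with h2 | h2 <;>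
      rcases le_total 0 x with h3 | h3 <;> rcases le_total 0 y with h4 | h4 <;>
      simp [h1, h2, h3, h4, hR] <;> linarith
  set F : ℝ → ℝ := fun x => f (π x) + (x - π x) with hF
  have hFm : StrictMono F := by
    intro x y hxy
    obtain ⟨h1, h2⟩ := hπlip x y hxy.le
    rcases h1.eq_or_lt with h | h
    · simp only [hF, h]; linarith
    · have := hf (hπ0 x) (hπ0 y) h
      simp only [hF]; linarith
  have hFc : Continuous F := (hc.comp_continuous hπc hπ0).add (continuous_id.sub hπc)
  have hfR : 0 ≤ f R := by
    rw [← h0]; exact hf.monotoneOn (mem_Ici.2 le_rfl) hR hR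
  have hFs : Function.Surjective F := by
    refine hFc.surjective ?_ ?_
    · refine tendsto_atTop_mono (f := fun x => x - R) (fun x => ?_)
        (tendsto_atTop_add_const_right _ _ tendsto_id)
      have : f 0 ≤ f (π x) := hf.monotoneOn (mem_Ici.2 le_rfl) (hπ0 x) (hπ0 x)
      have := hπR x
      simp only [hF]; linarith
    · refine tendsto_atBot_mono (fun x => (?_ : F x ≤ x + f R))
        (tendsto_atBot_add_const_right _ _ tendsto_id)
      have : f (π x) ≤ f R := hf.monotoneOn (hπ0 x) hR (hπR x)
      have := hπ0 x
      simp only [hF]; linarith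
  let e := hFm.orderIsoOfSurjective F hFs
  refine ⟨e.symm, e.symm.continuous.continuousOn, fun w hw => ?_⟩
  have hFe : F (e.symm w) = w := e.apply_symm_apply w
  have hF0 : F 0 = 0 := by simp [hF, hπid 0 le_rfl hR, h0]
  have hFR : F R = f R := by simp [hF, hπid R hR le_rfl]
  have h1 : 0 ≤ e.symm w := by
    rw [← hFm.le_iff_le, hFe, hF0]; exact hw.1
  have h2 : e.symm w ≤ R := by
    rw [← hFm.le_iff_le, hFe, hFR]; exact hw.2
  refine ⟨h1, ?_⟩
  have : F (e.symm w) = f (e.symm w) := by simp [hF, hπid _ h1 h2]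
  rw [← this, hFe]

variable {K : ℕ} {ρ : Measure ℝ} {μ : Fin K → ℝ} {i : Fin K}

/-- `r` lists the ratios of the allocation to arm `a` and to the best arm `i` for which the anchor
function vanishes and all indexes have the same value `N i * w`. -/
structure IsBalanced (ρ : Measure ℝ) (μ : Fin K → ℝ) (i : Fin K) (r : Fin K → ℝ) (w : ℝ) :
    Prop where
  pos : ∀ a, 0 < r a
  leader : r i = 1
  index_eq : ∀ a, a ≠ i → scaledIndex ρ (μ i) (μ a) (r a) = w
  anchor_eq : ∑ a ∈ Finset.univ.erase i, klRatio ρ (μ i) (μ a) (r a) = 1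

lemma exists_ne_of_two_le (hK : 2 ≤ K) (i : Fin K) : ∃ a, a ≠ i := by
  have : Nontrivial (Fin K) := Fin.nontrivial_iff_two_le.2 hK
  exact exists_ne i

/-- The ratios are parametrised by the common value `w` of the scaled indexes; the anchor function
is continuous in `w`, negative at `w = 0`, and nonnegative when the ratio of the arm with the
smallest limiting index is large. -/
lemma exists_isBalanced (hK : 2 ≤ K) (hρ : Nondegenerate ρ) (hμ : ∀ a, μ a ∈ meanSpace ρ)
    (hi : ∀ a, a ≠ i → μ a < μ i) : ∃ r w, IsBalanced ρ μ i r w := by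
  obtain ⟨b, hb⟩ := exists_ne_of_two_le hK i
  obtain ⟨c, hc, hcmin⟩ := Finset.exists_min_image (Finset.univ.erase i)
    (fun a => kl ρ (μ i) (μ a)) ⟨b, by simp [hb]⟩
  have hci : c ≠ i := Finset.ne_of_mem_erase hc
  obtain ⟨R, hR, hR1⟩ := exists_le_klRatio hρ (hμ i) (hμ c) (hi c hci) 1
  set W := scaledIndex ρ (μ i) (μ c) R with hW
  have hWc : W < kl ρ (μ i) (μ c) := scaledIndex_lt hρ (hμ i) (hμ c) (hi c hci) hR.le
  have hW0 : 0 ≤ W := by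
    rw [← scaledIndex_zero (ρ := ρ) (p := μ i) (q := μ c)]
    exact (strictMonoOn_scaledIndex hρ (hμ i) (hμ c) (hi c hci)).monotoneOn
      (mem_Ici.2 le_rfl) hR.le hR.le
  have hg : ∀ a, ∃ g : ℝ → ℝ, a ≠ i → ContinuousOn g (Icc 0 W) ∧
      ∀ w ∈ Icc 0 W, 0 ≤ g w ∧ scaledIndex ρ (μ i) (μ a) (g w) = w := by
    intro a
    by_cases ha : a = i
    · exact ⟨id, fun h => absurd ha h⟩
    have hWa : W < kl ρ (μ i) (μ a) := hWc.trans_le (hcmin a (by simp [ha]))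
    obtain ⟨Ra, hRa, hle⟩ := exists_le_scaledIndex hρ (hμ i) (hμ a) (hi a ha) hWa
    obtain ⟨g, hg, hg'⟩ := exists_continuousOn_rightInverse
      (strictMonoOn_scaledIndex hρ (hμ i) (hμ a) (hi a ha))
      (continuousOn_scaledIndex hρ (hμ i) (hμ a) (hi a ha)) scaledIndex_zero hRa
    have hsub : Icc 0 W ⊆ Icc 0 (scaledIndex ρ (μ i) (μ a) Ra) := Icc_subset_Icc_right hle
    exact ⟨g, fun _ => ⟨hg.mono hsub, fun w hw => hg' w (hsub hw)⟩⟩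
  choose g hg using hg
  have hinj : ∀ a, a ≠ i → ∀ w ∈ Icc 0 W, ∀ s, 0 ≤ s → scaledIndex ρ (μ i) (μ a) s = w →
      g a w = s := fun a ha w hw s hs h =>
    (strictMonoOn_scaledIndex hρ (hμ i) (hμ a) (hi a ha)).injOn ((hg a ha).2 w hw).1 hs
      (((hg a ha).2 w hw).2.trans h.symm)
  set G : ℝ → ℝ := fun w => ∑ a ∈ Finset.univ.erase i, klRatio ρ (μ i) (μ a) (g a w) with hG
  have hGc : ContinuousOn G (Icc 0 W) := by
    refine continuousOn_finsetSum _ fun a ha => ?_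
    have ha := Finset.ne_of_mem_erase ha
    exact (continuousOn_klRatio hρ (hμ i) (hμ a) (hi a ha)).comp (hg a ha).1
      fun w hw => ((hg a ha).2 w hw).1
  have hG0 : G 0 = 0 := by
    refine Finset.sum_eq_zero fun a ha => ?_
    rw [hinj a (Finset.ne_of_mem_erase ha) 0 ⟨le_rfl, hW0⟩ 0 le_rfl scaledIndex_zero, klRatio_zero]
  have hGW : 1 ≤ G W := by
    refine hR1.trans ?_
    rw [← hinj c hci W ⟨hW0, le_rfl⟩ R hR.le rfl]
    refine Finset.single_le_sum (f := fun a => klRatio ρ (μ i) (μ a) (g a W)) (fun a ha => ?_) hc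
    have ha := Finset.ne_of_mem_erase ha
    exact klRatio_nonneg hρ (hμ i) (hμ a) (hi a ha) ((hg a ha).2 W ⟨hW0, le_rfl⟩).1
  obtain ⟨w, hw, hGw⟩ := intermediate_value_Icc hW0 hGc ⟨by rw [hG0]; exact zero_le_one, hGW⟩
  have hw0 : w ≠ 0 := by
    rintro rfl
    rw [hG0] at hGw
    exact zero_ne_one hGw
  have hpos : ∀ a, a ≠ i → 0 < g a w := fun a ha => by
    refine lt_of_le_of_ne ((hg a ha).2 w hw).1 fun h => hw0 ?_
    rw [← ((hg a ha).2 w hw).2, ← h, scaledIndex_zero]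
  refine ⟨Function.update (fun a => g a w) i 1, w, fun a => ?_, by simp, fun a ha => ?_, ?_⟩
  · rcases eq_or_ne a i with rfl | ha
    · simp
    · simpa [ha] using hpos a ha
  · simpa [ha] using ((hg a ha).2 w hw).2
  · rw [← hGw]
    refine Finset.sum_congr rfl fun a ha => ?_
    simp [Finset.ne_of_mem_erase ha]

lemma mixMean_eq_mix (m N : Fin K → ℝ) {j : Fin K} (hN : 0 < N j) (a : Fin K) :
    mixMean m N j a = mix (m j) (m a) (N a / N j) := by
  rw [mixMean, mix]
  have h : N j * (1 + N a / N j) = N j + N a := by field_simp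
  rw [← h, show N j * m j + N a * m a = N j * (m j + N a / N j * m a) by field_simp]
  exact mul_div_mul_left _ _ hN.ne'

lemma index_eq_scaledIndex (ρ : Measure ℝ) (m N : Fin K → ℝ) {j : Fin K} (hN : 0 < N j)
    (a : Fin K) : index ρ m N j a = N j * scaledIndex ρ (m j) (m a) (N a / N j) := by
  rw [index, mixMean_eq_mix m N hN, scaledIndex]
  field_simp

lemma anchor_eq_sum_klRatio (ρ : Measure ℝ) (m N : Fin K → ℝ) {j : Fin K} (hN : 0 < N j) :
    anchor ρ m N j
      = (∑ a ∈ Finset.univ.erase j, klRatio ρ (m j) (m a) (N a / N j)) - 1 := by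
  simp only [anchor, klRatio, mixMean_eq_mix m N hN]

lemma index_eq_zero (ρ : Measure ℝ) (m N : Fin K → ℝ) {j : Fin K} (hN : N j = 0) (a : Fin K) :
    index ρ m N j a = 0 := by
  rcases eq_or_ne (N a) 0 with h | h
  · simp [index, hN, h]
  · simp [index, mixMean, hN, mul_div_cancel_left₀ _ h]

/-- The allocation proportional to `r`. -/
noncomputable def allocation (r : Fin K → ℝ) (b : Fin K) : ℝ := r b / ∑ c, r c

namespace IsBalanced

variable {r : Fin K → ℝ} {w : ℝ}

lemma sum_pos (h : IsBalanced ρ μ i r w) : 0 < ∑ c, r c :=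
  Finset.sum_pos (fun c _ => h.pos c) ⟨i, Finset.mem_univ i⟩

lemma allocation_mem (h : IsBalanced ρ μ i r w) : allocation r ∈ stdSimplex ℝ (Fin K) := by
  refine ⟨fun b => (div_pos (h.pos b) h.sum_pos).le, ?_⟩
  simp only [allocation]
  rw [← Finset.sum_div, div_self h.sum_pos.ne']

lemma allocation_leader_pos (h : IsBalanced ρ μ i r w) : 0 < allocation r i :=
  div_pos (h.pos i) h.sum_pos

lemma allocation_div (h : IsBalanced ρ μ i r w) (a : Fin K) :
    allocation r a / allocation r i = r a := by
  have := h.sum_pos.ne'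
  rw [allocation, allocation, h.leader]
  field_simp

lemma index_allocation (h : IsBalanced ρ μ i r w) {a : Fin K} (ha : a ≠ i) :
    index ρ μ (allocation r) i a = allocation r i * w := by
  rw [index_eq_scaledIndex ρ μ _ h.allocation_leader_pos, h.allocation_div, h.index_eq a ha]

/-- A linear upper bound for the indexes, tangent at the balanced allocation, with the explicit
remainder. -/
lemma index_add (h : IsBalanced ρ μ i r w) (hρ : Nondegenerate ρ) (hμ : ∀ a, μ a ∈ meanSpace ρ)
    (hi : ∀ a, a ≠ i → μ a < μ i) {N : Fin K → ℝ} (hN : 0 < N i) {a : Fin K} (hNa : 0 ≤ N a)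
    (ha : a ≠ i) :
    index ρ μ N i a
      + (N i + N a) * kl ρ (mix (μ i) (μ a) (N a / N i)) (mix (μ i) (μ a) (r a))
      = kl ρ (μ a) (mix (μ i) (μ a) (r a)) * (N i * klRatio ρ (μ i) (μ a) (r a) + N a) := by
  have hD := kl_mix_right_pos hρ (hμ i) (hμ a) (hi a ha) (h.pos a).le
  have h1 := kl_add_mul_kl (ρ := ρ) (p := μ i) (q := μ a) (div_nonneg hNa hN.le)
    (mix (μ i) (μ a) (r a))
  rw [index_eq_scaledIndex ρ μ N hN, klRatio]
  field_simp
  field_simp at h1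
  linarith

/-- A lower bound `v` on the index of `a`, divided by the divergence of `a` at the balanced ratio, is
bounded by a linear function of the allocation; these functions add up to `1` on the simplex, see
`IsBalanced.sum_tangent`. -/
lemma div_le_of_le_index (h : IsBalanced ρ μ i r w) (hρ : Nondegenerate ρ)
    (hμ : ∀ a, μ a ∈ meanSpace ρ) (hi : ∀ a, a ≠ i → μ a < μ i) {N : Fin K → ℝ} (hN : 0 < N i)
    {a : Fin K} (hNa : 0 ≤ N a) (ha : a ≠ i) {v : ℝ} (hv : v ≤ index ρ μ N i a) :
    v / kl ρ (μ a) (mix (μ i) (μ a) (r a)) ≤ N i * klRatio ρ (μ i) (μ a) (r a) + N a := by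
  have hD := kl_mix_right_pos hρ (hμ i) (hμ a) (hi a ha) (h.pos a).le
  have h1 := h.index_add hρ hμ hi hN hNa ha
  have h2 := mul_nonneg (by linarith : 0 ≤ N i + N a)
    (kl_nonneg hρ (mix_mem (hμ i) (hμ a) (hi a ha) (div_nonneg hNa hN.le))
      (mix_mem (hμ i) (hμ a) (hi a ha) (h.pos a).le))
  rw [div_le_iff₀ hD]
  linarith

lemma sum_tangent (h : IsBalanced ρ μ i r w) {N : Fin K → ℝ} (hN : N ∈ stdSimplex ℝ (Fin K)) :
    ∑ a ∈ Finset.univ.erase i, (N i * klRatio ρ (μ i) (μ a) (r a) + N a) = 1 := by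
  rw [Finset.sum_add_distrib, ← Finset.mul_sum, h.anchor_eq, mul_one,
    Finset.add_sum_erase _ _ (Finset.mem_univ i)]
  exact hN.2

lemma allocation_div_kl (h : IsBalanced ρ μ i r w) (hρ : Nondegenerate ρ)
    (hμ : ∀ a, μ a ∈ meanSpace ρ) (hi : ∀ a, a ≠ i → μ a < μ i) {a : Fin K} (ha : a ≠ i) :
    allocation r i * w / kl ρ (μ a) (mix (μ i) (μ a) (r a))
      = allocation r i * klRatio ρ (μ i) (μ a) (r a) + allocation r a := by
  have hD := kl_mix_right_pos hρ (hμ i) (hμ a) (hi a ha) (h.pos a).le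
  have h1 := h.index_add hρ hμ hi h.allocation_leader_pos (h.allocation_mem.1 a) ha
  rw [h.allocation_div, kl_self, mul_zero, add_zero, h.index_allocation ha] at h1
  rw [div_eq_iff hD.ne', h1, mul_comm]

lemma allocation_sum_div_kl (h : IsBalanced ρ μ i r w) (hρ : Nondegenerate ρ)
    (hμ : ∀ a, μ a ∈ meanSpace ρ) (hi : ∀ a, a ≠ i → μ a < μ i) :
    ∑ a ∈ Finset.univ.erase i, allocation r i * w / kl ρ (μ a) (mix (μ i) (μ a) (r a)) = 1 := by
  rw [← h.sum_tangent h.allocation_mem]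
  exact Finset.sum_congr rfl fun a ha =>
    h.allocation_div_kl hρ hμ hi (Finset.ne_of_mem_erase ha)

lemma value_pos (h : IsBalanced ρ μ i r w) (hK : 2 ≤ K) (hρ : Nondegenerate ρ)
    (hμ : ∀ a, μ a ∈ meanSpace ρ) (hi : ∀ a, a ≠ i → μ a < μ i) : 0 < w := by
  obtain ⟨a, ha⟩ := exists_ne_of_two_le hK i
  rw [← h.index_eq a ha, ← scaledIndex_zero (ρ := ρ) (p := μ i) (q := μ a)]
  exact strictMonoOn_scaledIndex hρ (hμ i) (hμ a) (hi a ha) (mem_Ici.2 le_rfl) (h.pos a).le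
    (h.pos a)

lemma iInf_index_allocation (h : IsBalanced ρ μ i r w) (hK : 2 ≤ K) :
    ⨅ a : {a : Fin K // a ≠ i}, index ρ μ (allocation r) i a = allocation r i * w := by
  obtain ⟨b, hb⟩ := exists_ne_of_two_le hK i
  have : Nonempty {a : Fin K // a ≠ i} := ⟨⟨b, hb⟩⟩
  rw [iInf_congr fun a : {a : Fin K // a ≠ i} => h.index_allocation a.2, ciInf_const]

/-- An allocation with minimal index at least that of the balanced allocation is the balanced
allocation. -/
lemma eq_allocation_of_le (h : IsBalanced ρ μ i r w) (hK : 2 ≤ K) (hρ : Nondegenerate ρ)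
    (hμ : ∀ a, μ a ∈ meanSpace ρ) (hi : ∀ a, a ≠ i → μ a < μ i) {N : Fin K → ℝ}
    (hN : N ∈ stdSimplex ℝ (Fin K))
    (hle : ∀ a, a ≠ i → allocation r i * w ≤ index ρ μ N i a) : N = allocation r := by
  have hV : 0 < allocation r i * w :=
    mul_pos h.allocation_leader_pos (h.value_pos hK hρ hμ hi)
  obtain ⟨b, hb⟩ := exists_ne_of_two_le hK i
  have hNi : 0 < N i := by
    refine lt_of_le_of_ne (hN.1 i) fun h0 => ?_
    have := hle b hb
    rw [index_eq_zero ρ μ N h0.symm] at this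
    linarith
  have heq : ∀ a ∈ Finset.univ.erase i, allocation r i * w / kl ρ (μ a) (mix (μ i) (μ a) (r a))
      = N i * klRatio ρ (μ i) (μ a) (r a) + N a := by
    refine (Finset.sum_eq_sum_iff_of_le fun a ha => ?_).1 ?_
    · have ha := Finset.ne_of_mem_erase ha
      exact h.div_le_of_le_index hρ hμ hi hNi (hN.1 a) ha (hle a ha)
    · rw [h.allocation_sum_div_kl hρ hμ hi, h.sum_tangent hN]
  have hratio : ∀ a, N a = r a * N i := by
    intro a
    rcases eq_or_ne a i with rfl | ha
    · rw [h.leader, one_mul]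
    have hD := kl_mix_right_pos hρ (hμ i) (hμ a) (hi a ha) (h.pos a).le
    have h1 := h.index_add hρ hμ hi hNi (hN.1 a) ha
    have h2 := heq a (by simp [ha])
    rw [div_eq_iff hD.ne'] at h2
    have h3 := hle a ha
    have hm1 := mix_mem (hμ i) (hμ a) (hi a ha) (div_nonneg (hN.1 a) hNi.le)
    have hm2 := mix_mem (hμ i) (hμ a) (hi a ha) (h.pos a).le
    have hmix : mix (μ i) (μ a) (N a / N i) = mix (μ i) (μ a) (r a) := by
      by_contra hne
      have := mul_pos (add_pos_of_pos_of_nonneg hNi (hN.1 a)) (kl_pos hρ hm1 hm2 hne)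
      linarith
    have := (strictAntiOn_mix (hi a ha)).injOn (div_nonneg (hN.1 a) hNi.le) (h.pos a).le hmix
    rw [← this]
    field_simp
  have hsum : ∑ a, r a * N i = 1 := (Finset.sum_congr rfl fun a _ => (hratio a).symm).trans hN.2
  rw [← Finset.sum_mul] at hsum
  funext a
  rw [hratio a, allocation, eq_div_iff h.sum_pos.ne']
  linear_combination r a * hsum

lemma isOptimalAllocation (h : IsBalanced ρ μ i r w) (hK : 2 ≤ K) (hρ : Nondegenerate ρ)
    (hμ : ∀ a, μ a ∈ meanSpace ρ) (hi : ∀ a, a ≠ i → μ a < μ i) :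
    IsOptimalAllocation ρ μ i (allocation r) := by
  refine ⟨h.allocation_mem, fun N hN => ?_⟩
  simp only [mem_ofPred_eq]
  rw [h.iInf_index_allocation hK]
  by_contra! hlt
  have hle : ∀ a, a ≠ i → allocation r i * w < index ρ μ N i a := fun a ha =>
    hlt.trans_le (ciInf_le (finite_range _).bddBelow (⟨a, ha⟩ : {a : Fin K // a ≠ i}))
  have heq := h.eq_allocation_of_le hK hρ hμ hi hN fun a ha => (hle a ha).le
  rw [heq, h.iInf_index_allocation hK] at hlt
  exact lt_irrefl _ hlt

lemma eq_allocation (h : IsBalanced ρ μ i r w) (hK : 2 ≤ K) (hρ : Nondegenerate ρ)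
    (hμ : ∀ a, μ a ∈ meanSpace ρ) (hi : ∀ a, a ≠ i → μ a < μ i) {N : Fin K → ℝ}
    (hN : IsOptimalAllocation ρ μ i N) : N = allocation r := by
  refine h.eq_allocation_of_le hK hρ hμ hi hN.1 fun a ha => ?_
  have := hN.2 h.allocation_mem
  simp only [mem_ofPred_eq] at this
  rw [h.iInf_index_allocation hK] at this
  exact this.trans (ciInf_le (finite_range _).bddBelow (⟨a, ha⟩ : {a : Fin K // a ≠ i}))

end IsBalanced

/-! ### Positivity of `ε(μ)` -/

lemma rMin_pos (hρ : Nondegenerate ρ) (hμ : ∀ a, μ a ∈ meanSpace ρ) (i : Fin K) :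
    0 < rMin ρ μ := by
  have : Nonempty (Fin K) := ⟨i⟩
  obtain ⟨a, ha⟩ := Finite.exists_min (fun a : Fin K =>
    min ((μ a : EReal) - ⨅ x ∈ meanSpace ρ, (x : EReal))
    ((⨆ x ∈ meanSpace ρ, (x : EReal)) - (μ a : EReal)))
  refine lt_of_lt_of_le ?_ (le_iInf ha)
  obtain ⟨η, hη, hball⟩ := Metric.isOpen_iff.1 (isOpen_meanSpace hρ) (μ a) (hμ a)
  have hl : μ a - η / 2 ∈ meanSpace ρ := hball (by
    rw [Metric.mem_ball, Real.dist_eq, abs_lt]; constructor <;> linarith)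
  have hu : μ a + η / 2 ∈ meanSpace ρ := hball (by
    rw [Metric.mem_ball, Real.dist_eq, abs_lt]; constructor <;> linarith)
  refine lt_min ?_ ?_
  · refine EReal.sub_pos.2 (lt_of_le_of_lt (iInf₂_le _ hl) ?_)
    exact EReal.coe_lt_coe_iff.2 (by linarith)
  · refine EReal.sub_pos.2 (lt_of_lt_of_le ?_ (le_iSup₂ (f := fun (x : ℝ) _ => (x : EReal)) _ hu))
    exact EReal.coe_lt_coe_iff.2 (by linarith)

lemma gapMin_pos (hK : 2 ≤ K) (hi : ∀ a, a ≠ i → μ a < μ i) : 0 < gapMin μ i := by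
  obtain ⟨b, hb⟩ := exists_ne_of_two_le hK i
  have : Nonempty {a : Fin K // a ≠ i} := ⟨⟨b, hb⟩⟩
  obtain ⟨a, ha⟩ := Finite.exists_min (fun a : {a : Fin K // a ≠ i} => μ i - μ a)
  exact lt_of_lt_of_le (sub_pos.2 (hi a a.2)) (le_ciInf ha)

lemma epsConst_pos (hK : 2 ≤ K) (hρ : Nondegenerate ρ) (hμ : ∀ a, μ a ∈ meanSpace ρ)
    (hi : ∀ a, a ≠ i → μ a < μ i) : 0 < epsConst ρ μ i := by
  have hg := gapMin_pos hK hi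
  refine EReal.toReal_pos (lt_min ?_ ?_) ?_
  · exact EReal.coe_pos.2 (by positivity)
  · exact EReal.div_pos (rMin_pos hρ hμ i) (by norm_num) (by exact EReal.coe_ne_top 2)
  · exact ne_top_of_le_ne_top (EReal.coe_ne_top _) (min_le_left _ _)

end Optimal

/-! ### Consequences of a single decision of the algorithm -/

section Decision

variable {K : ℕ} {ρ : Measure ℝ} {μ : Fin K → ℝ} {i : Fin K} {r : Fin K → ℝ} {w : ℝ}

/-- Constants that work for each arm can be chosen uniformly in the arm. -/
lemma exists_uniform_const {P : Fin K → ℝ → ℝ → Prop}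
    (h : ∀ a, a ≠ i → ∀ᶠ C in atTop, ∀ᶠ δ in 𝓝[>] (0 : ℝ), P a C δ) :
    ∃ C, 0 ≤ C ∧ ∀ᶠ δ in 𝓝[>] (0 : ℝ), ∀ a, a ≠ i → P a C δ := by
  have h1 : ∀ᶠ C in atTop, ∀ a, a ≠ i → ∀ᶠ δ in 𝓝[>] (0 : ℝ), P a C δ :=
    eventually_all.2 fun a => eventually_imp_distrib_left.2 (h a)
  obtain ⟨C, hC, hC0⟩ := (h1.and (eventually_ge_atTop 0)).exists
  exact ⟨C, hC0, eventually_all.2 fun a => eventually_imp_distrib_left.2 (hC a)⟩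

/-- For means close to `μ`, the anchor function at `i` is defined and `i` is the best arm. -/
lemma eventually_forall_mem_meanSpace (hρ : Nondegenerate ρ) (hμ : ∀ a, μ a ∈ meanSpace ρ)
    (hi : ∀ a, a ≠ i → μ a < μ i) :
    ∀ᶠ δ in 𝓝[>] (0 : ℝ), ∀ m : Fin K → ℝ, (∀ b, |m b - μ b| ≤ δ) →
      (∀ b, m b ∈ meanSpace ρ) ∧ ∀ b, b ≠ i → m b < m i := by
  have h1 : ∀ᶠ m in 𝓝 μ, (∀ b, m b ∈ meanSpace ρ) ∧ ∀ b, b ≠ i → m b < m i := by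
    refine (eventually_all.2 fun b => ?_).and
      (eventually_all.2 fun b => eventually_imp_distrib_left.2 fun hb => ?_)
    · exact (continuous_apply b).continuousAt.eventually ((isOpen_meanSpace hρ).mem_nhds (hμ b))
    · exact (continuous_apply b).continuousAt.eventually_lt (continuous_apply i).continuousAt
        (hi b hb)
  obtain ⟨η, hη, h⟩ := Metric.eventually_nhds_iff.1 h1
  filter_upwards [Ioo_mem_nhdsGT hη] with δ hδ m hm
  refine h (lt_of_le_of_lt ((dist_pi_le_iff hδ.1.le).2 fun b => ?_) hδ.2)
  rw [Real.dist_eq]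
  exact hm b

lemma klRatio_le_sum (hρ : Nondegenerate ρ) {m s : Fin K → ℝ} (hm : ∀ b, m b ∈ meanSpace ρ)
    (hmi : ∀ b, b ≠ i → m b < m i) (hs : ∀ b, 0 ≤ s b) {a : Fin K} (ha : a ≠ i) :
    klRatio ρ (m i) (m a) (s a)
      ≤ ∑ b ∈ Finset.univ.erase i, klRatio ρ (m i) (m b) (s b) :=
  Finset.single_le_sum (f := fun b => klRatio ρ (m i) (m b) (s b))
    (fun b hb => klRatio_nonneg hρ (hm i) (hm b) (hmi b (Finset.ne_of_mem_erase hb)) (hs b))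
    (by simp [ha])

/-- If the anchor function is nonpositive, then all ratios are bounded by a constant. -/
lemma exists_ratio_le (hρ : Nondegenerate ρ) (hμ : ∀ a, μ a ∈ meanSpace ρ)
    (hi : ∀ a, a ≠ i → μ a < μ i) :
    ∃ R, 0 ≤ R ∧ ∀ᶠ δ in 𝓝[>] (0 : ℝ), ∀ m s : Fin K → ℝ, (∀ b, |m b - μ b| ≤ δ) →
      (∀ b, 0 ≤ s b) → ∑ a ∈ Finset.univ.erase i, klRatio ρ (m i) (m a) (s a) ≤ 1 →
      ∀ b, b ≠ i → s b ≤ R := by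
  have key : ∀ a, a ≠ i → ∀ᶠ C in atTop, ∀ᶠ δ in 𝓝[>] (0 : ℝ), ∀ p' q', |p' - μ i| ≤ δ →
      |q' - μ a| ≤ δ → ∀ t, 0 ≤ t → klRatio ρ p' q' t ≤ 1 → t ≤ C := by
    intro a ha
    obtain ⟨R, hR, hR1⟩ := exists_le_klRatio hρ (hμ i) (hμ a) (hi a ha) 1
    obtain ⟨C, hC⟩ := ((isRegular_klRatio hρ (hμ i) (hμ a) (hi a ha) hR).le_of_apply_le 0).exists
    filter_upwards [eventually_ge_atTop (R + |C|)] with C' hC'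
    filter_upwards [hC, Ioo_mem_nhdsGT one_pos] with δ hδ hδ1 p' q' hp' hq' t ht hle
    have h1 := hδ p' q' hp' hq' t ht (by linarith)
    have h2 : C * δ ≤ |C| * 1 :=
      mul_le_mul (le_abs_self C) hδ1.2.le hδ1.1.le (abs_nonneg C)
    linarith
  obtain ⟨R, hR, h⟩ := exists_uniform_const key
  refine ⟨R, hR, ?_⟩
  filter_upwards [h, eventually_forall_mem_meanSpace hρ hμ hi] with δ hδ hS m s hm hs hsum b hb
  obtain ⟨hmS, hmi⟩ := hS m hm
  exact hδ b hb _ _ (hm i) (hm b) _ (hs b) ((klRatio_le_sum hρ hmS hmi hs hb).trans hsum)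

/-- If the anchor function is nonpositive, some arm has a ratio not much above the balanced one, so
that the smallest index is not much above the balanced value, and neither is the ratio of an arm
with that index. -/
lemma exists_challenger_ratio_le (h : IsBalanced ρ μ i r w) (hρ : Nondegenerate ρ)
    (hμ : ∀ a, μ a ∈ meanSpace ρ) (hi : ∀ a, a ≠ i → μ a < μ i) (B : ℝ) :
    ∃ C, 0 ≤ C ∧ ∀ᶠ δ in 𝓝[>] (0 : ℝ), ∀ m s : Fin K → ℝ, (∀ b, |m b - μ b| ≤ δ) →
      (∀ b, 0 ≤ s b) → ∑ a ∈ Finset.univ.erase i, klRatio ρ (m i) (m a) (s a) ≤ 1 →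
      ∀ b, b ≠ i → (∀ a, a ≠ i → scaledIndex ρ (m i) (m b) (s b)
        ≤ scaledIndex ρ (m i) (m a) (s a) + B * δ) → s b ≤ r b + C * δ := by
  obtain ⟨C₁, hC₁, h₁⟩ := exists_uniform_const fun a (ha : a ≠ i) =>
    (isRegular_klRatio hρ (hμ i) (hμ a) (hi a ha) (h.pos a)).le_of_apply_le 0
  obtain ⟨C₂, hC₂, h₂⟩ := exists_uniform_const fun a (ha : a ≠ i) =>
    (isRegular_scaledIndex hρ (hμ i) (hμ a) (hi a ha) (h.pos a)).apply_le_of_le hC₁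
  obtain ⟨C₃, hC₃, h₃⟩ := exists_uniform_const fun a (ha : a ≠ i) =>
    (isRegular_scaledIndex hρ (hμ i) (hμ a) (hi a ha) (h.pos a)).le_of_apply_le (C₂ + B)
  refine ⟨C₃, hC₃, ?_⟩
  filter_upwards [h₁, h₂, h₃] with δ h₁ h₂ h₃ m s hm hs hsum b hb hle
  have hne : (Finset.univ.erase i).Nonempty := ⟨b, by simp [hb]⟩
  obtain ⟨a, ha, hab⟩ := Finset.exists_le_of_sum_le hne (hsum.trans h.anchor_eq.ge)
  have ha := Finset.ne_of_mem_erase ha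
  have e1 := h₁ a ha _ _ (hm i) (hm a) _ (hs a) (by linarith)
  have e2 := h₂ a ha _ _ (hm i) (hm a) _ (hs a) e1
  rw [h.index_eq a ha] at e2
  refine h₃ b hb _ _ (hm i) (hm b) _ (hs b) ?_
  rw [h.index_eq b hb]
  linarith [hle a ha]

/-- If the anchor function is positive and no ratio is much above the balanced one, then no ratio is
much below it. -/
lemma exists_le_ratio_of_leader (h : IsBalanced ρ μ i r w) (hρ : Nondegenerate ρ)
    (hμ : ∀ a, μ a ∈ meanSpace ρ) (hi : ∀ a, a ≠ i → μ a < μ i) {A : ℝ} (hA : 0 ≤ A) :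
    ∃ C, 0 ≤ C ∧ ∀ᶠ δ in 𝓝[>] (0 : ℝ), ∀ m s : Fin K → ℝ, (∀ b, |m b - μ b| ≤ δ) →
      (∀ b, 0 ≤ s b) → (∀ a, a ≠ i → s a ≤ r a + A * δ) →
      1 < ∑ a ∈ Finset.univ.erase i, klRatio ρ (m i) (m a) (s a) →
      ∀ b, b ≠ i → r b - C * δ ≤ s b := by
  obtain ⟨C₁, hC₁, h₁⟩ := exists_uniform_const fun a (ha : a ≠ i) =>
    (isRegular_klRatio hρ (hμ i) (hμ a) (hi a ha) (h.pos a)).apply_le_of_le hA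
  obtain ⟨C₂, hC₂, h₂⟩ := exists_uniform_const fun a (ha : a ≠ i) =>
    (isRegular_klRatio hρ (hμ i) (hμ a) (hi a ha) (h.pos a)).le_of_le_apply (K * C₁)
  refine ⟨C₂, hC₂, ?_⟩
  filter_upwards [h₁, h₂, self_mem_nhdsWithin] with δ h₁ h₂ hδ m s hm hs hle hsum b hb
  have hδ : 0 < δ := hδ
  refine h₂ b hb _ _ (hm i) (hm b) _ (hs b) ?_
  have hbm : b ∈ Finset.univ.erase i := by simp [hb]
  have e1 := h.anchor_eq
  rw [← Finset.add_sum_erase _ _ hbm] at e1 hsum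
  have e2 : ∑ a ∈ (Finset.univ.erase i).erase b, klRatio ρ (m i) (m a) (s a)
      ≤ ∑ a ∈ (Finset.univ.erase i).erase b, (klRatio ρ (μ i) (μ a) (r a) + C₁ * δ) :=
    Finset.sum_le_sum fun a ha => by
      have ha := Finset.ne_of_mem_erase (Finset.mem_of_mem_erase ha)
      exact h₁ a ha _ _ (hm i) (hm a) _ (hs a) (hle a ha)
  rw [Finset.sum_add_distrib, Finset.sum_const, nsmul_eq_mul] at e2
  have e3 : ((((Finset.univ.erase i).erase b).card : ℕ) : ℝ) ≤ K := by
    have := Finset.card_le_univ ((Finset.univ.erase i).erase b)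
    rw [Fintype.card_fin] at this
    exact_mod_cast this
  have e4 := mul_le_mul_of_nonneg_right e3 (mul_nonneg hC₁ hδ.le)
  linarith

/-- The three types of decisions, in terms of the ratios of the numbers of pulls: exploration, pull
of the leader, pull of a challenger. -/
lemma IsChoice.cases {v : Variant} {α : ℝ} {n : ℕ} {N m : Fin K → ℝ} {a : Fin K}
    (hα : 0 ≤ α) (h : IsChoice v ρ α n N m a) (hm : ∀ b, m b ∈ meanSpace ρ)
    (hmi : ∀ b, b ≠ i → m b < m i) :
    N a < ((n : ℝ) + 1) ^ α ∨ 0 < N i ∧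
      ((a = i ∧ 1 < ∑ c ∈ Finset.univ.erase i, klRatio ρ (m i) (m c) (N c / N i)) ∨
       (a ≠ i ∧ ∑ c ∈ Finset.univ.erase i, klRatio ρ (m i) (m c) (N c / N i) ≤ 1 ∧
        ∀ c, c ≠ i → scaledIndex ρ (m i) (m a) (N a / N i)
          ≤ scaledIndex ρ (m i) (m c) (N c / N i) + Real.log (N c) / N i)) := by
  by_cases hex : ∃ b, N b < ((n : ℝ) + 1) ^ α
  · obtain ⟨b, hb⟩ := hex
    exact Or.inl ((h.1 ⟨b, hb⟩ b).trans_lt hb)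
  push Not at hex
  right
  have hN : ∀ b, 1 ≤ N b := fun b =>
    (Real.one_le_rpow (by linarith [Nat.cast_nonneg (α := ℝ) n]) hα).trans (hex b)
  have hNi : 0 < N i := one_pos.trans_le (hN i)
  obtain ⟨h1, h2⟩ := h.2 hex hm i hmi
  rw [anchor_eq_sum_klRatio ρ m N hNi] at h1 h2
  refine ⟨hNi, ?_⟩
  rcases lt_or_ge 1 (∑ c ∈ Finset.univ.erase i, klRatio ρ (m i) (m c) (N c / N i)) with hlt | hle
  · exact Or.inl ⟨h1 (by linarith), hlt⟩
  · obtain ⟨hne, hsc⟩ := h2 (by linarith)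
    refine Or.inr ⟨hne, hle, fun c hc => ?_⟩
    -- Both variants satisfy this bound, as past the exploration the counts are at least `1`.
    have h3 : index ρ m N i a ≤ index ρ m N i c + Real.log (N c) := by
      have h4 := hsc c hc
      have h5 := Real.log_nonneg (hN a)
      have h6 := Real.log_nonneg (hN c)
      cases v <;> simp only [challengerScore] at h4 <;> linarith
    rw [index_eq_scaledIndex ρ m N hNi, index_eq_scaledIndex ρ m N hNi] at h3
    rw [← mul_le_mul_iff_of_pos_left hNi, mul_add, mul_div_cancel₀ _ hNi.ne']
    exact h3

end Decision

/-! ### Counting pulls -/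

section Count

variable {K : ℕ}

/-- The number of indices below `N` at which the sequence `s` takes the value `a`. -/
noncomputable def count (s : ℕ → Fin K) (N : ℕ) (a : Fin K) : ℝ :=
  (((Finset.range N).filter (fun n => s n = a)).card : ℝ)

variable (s : ℕ → Fin K)

lemma count_zero (a : Fin K) : count s 0 a = 0 := by simp [count]

lemma count_succ (N : ℕ) (a : Fin K) :
    count s (N + 1) a = count s N a + if s N = a then 1 else 0 := by
  rw [count, Finset.range_add_one, Finset.filter_insert]
  split_ifs with h
  · rw [Finset.card_insert_of_notMem (by simp)]
    simp [count]
  · simp [count]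

lemma count_nonneg (N : ℕ) (a : Fin K) : 0 ≤ count s N a := Nat.cast_nonneg _

lemma count_mono (a : Fin K) : Monotone (fun N => count s N a) := by
  refine monotone_nat_of_le_succ fun N => ?_
  rw [count_succ]
  split_ifs <;> linarith

lemma sum_count (N : ℕ) : ∑ a, count s N a = N := by
  induction N with
  | zero => simp [count_zero]
  | succ N ih =>
    simp_rw [count_succ, Finset.sum_add_distrib, ih]
    simp

lemma count_le (N : ℕ) (a : Fin K) : count s N a ≤ N := by
  rw [← sum_count s N]
  exact Finset.single_le_sum (fun b _ => count_nonneg s N b) (Finset.mem_univ a)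

/-- Either there is no pull of `b` between `S` and `N`, or there is a last one. -/
lemma count_eq_or_exists_last {S N : ℕ} (hSN : S ≤ N) (b : Fin K) :
    count s N b = count s S b ∨
      ∃ n, S ≤ n ∧ n < N ∧ s n = b ∧ count s N b = count s n b + 1 := by
  induction N, hSN using Nat.le_induction with
  | base => exact Or.inl rfl
  | succ N hN ih =>
    by_cases hb : s N = b
    · exact Or.inr ⟨N, hN, N.lt_succ_self, hb, by rw [count_succ, if_pos hb]⟩
    · have hc : count s (N + 1) b = count s N b := by rw [count_succ, if_neg hb, add_zero]
      rcases ih with h | ⟨n, h1, h2, h3, h4⟩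
      · exact Or.inl (hc.trans h)
      · exact Or.inr ⟨n, h1, h2.trans N.lt_succ_self, h3, hc.trans h4⟩

end Count

/-! ### Elementary asymptotics -/

section Asymptotics

lemma tendsto_const_mul_rpow_neg {ε β : ℝ} (hε : 0 < ε) (hβ : 0 < β) :
    Tendsto (fun n : ℕ => ε * (n : ℝ) ^ (-β)) atTop (𝓝[>] 0) := by
  refine tendsto_nhdsWithin_iff.2 ⟨?_, ?_⟩
  · have := ((tendsto_rpow_neg_atTop hβ).comp tendsto_natCast_atTop_atTop).const_mul ε
    rwa [mul_zero] at this
  · filter_upwards [eventually_gt_atTop 0] with n hn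
    have : (0 : ℝ) < n := by exact_mod_cast hn
    exact mul_pos hε (by positivity)

lemma rpow_neg_mul_le {β : ℝ} {n : ℕ} (hn : 0 < n) {x : ℝ} (hx : x ≤ n) :
    (n : ℝ) ^ (-β) * x ≤ (n : ℝ) ^ (1 - β) := by
  have hn : (0 : ℝ) < n := by exact_mod_cast hn
  rw [show (1 : ℝ) - β = -β + 1 by ring, Real.rpow_add hn, Real.rpow_one]
  gcongr

lemma eventually_rpow_add_one_le {α η : ℝ} (hα : α < 1) (hη : 0 < η) :
    ∀ᶠ N : ℕ in atTop, (N : ℝ) ^ α + 1 ≤ η * N := by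
  have h1 := (tendsto_rpow_neg_atTop (sub_pos.2 hα)).comp tendsto_natCast_atTop_atTop
  filter_upwards [h1.eventually_le_const (half_pos hη),
    tendsto_natCast_atTop_atTop (R := ℝ) |>.eventually_ge_atTop (2 / η),
    eventually_gt_atTop 0] with N hN hN' hN0
  have hN0 : (0 : ℝ) < N := by exact_mod_cast hN0
  rw [div_le_iff₀ hη] at hN'
  have h2 : (N : ℝ) ^ α = (N : ℝ) ^ (-(1 - α)) * N := by
    rw [← Real.rpow_add_one hN0.ne']
    congr 1
    ring
  have h3 := mul_le_mul_of_nonneg_right hN hN0.le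
  simp only [Function.comp] at h3
  linarith

lemma eventually_log_le_rpow {γ : ℝ} (hγ : 0 < γ) :
    ∀ᶠ N : ℕ in atTop, Real.log N ≤ (N : ℝ) ^ γ := by
  have h1 := (isLittleO_log_rpow_atTop hγ).bound one_pos
  filter_upwards [tendsto_natCast_atTop_atTop (R := ℝ) |>.eventually h1] with N hN
  rw [one_mul, Real.norm_eq_abs, Real.norm_eq_abs,
    abs_of_nonneg (a := (N : ℝ) ^ γ) (by positivity)] at hN
  exact (le_abs_self _).trans hN

end Asymptotics

/-! ### Convergence of the allocation along a trajectory with concentrated means -/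

section Trajectory

variable {K : ℕ} {v : Variant} {ρ : Measure ℝ} {μ : Fin K → ℝ} {α β ε : ℝ} {i : Fin K}
  {r : Fin K → ℝ} {w : ℝ}

/-- A trajectory of the algorithm: `s n` is the arm pulled in iteration `n + 1`, `m n` lists the
empirical means after `n` iterations, and these are within `ε * n ^ (-β)` of the true means from
time `T` on. -/
structure IsConcentrated (v : Variant) (ρ : Measure ℝ) (μ : Fin K → ℝ) (α β ε : ℝ)
    (s : ℕ → Fin K) (m : ℕ → Fin K → ℝ) (T : ℕ) : Prop where
  rule : ∀ n, IsChoice v ρ α n (count s n) (m n) (s n)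
  close : ∀ n, T ≤ n → ∀ a, |m n a - μ a| ≤ ε * (n : ℝ) ^ (-β)

variable {s : ℕ → Fin K} {m : ℕ → Fin K → ℝ} {T : ℕ}

/-- The number of pulls of the best arm grows linearly: whenever a challenger is pulled, its number
of pulls is at most a multiple of that of the best arm. -/
lemma exists_linear_le_count (hK : 2 ≤ K) (hρ : Nondegenerate ρ) (hμ : ∀ a, μ a ∈ meanSpace ρ)
    (hi : ∀ a, a ≠ i → μ a < μ i) (hα₀ : 0 ≤ α) (hα : α < 1) (hβ : 0 < β) (hε : 0 < ε) :
    ∃ c, 0 < c ∧ ∃ L : ℕ, 0 < L ∧ ∀ s m T, IsConcentrated v ρ μ α β ε s m T →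
      ∀ N, L * (T + 1) ≤ N → c * N ≤ count s N i := by
  obtain ⟨R, hR, hev⟩ := exists_ratio_le hρ hμ hi
  obtain ⟨n₀, hn₀⟩ := eventually_atTop.1 ((tendsto_const_mul_rpow_neg hε hβ).eventually
    (hev.and (eventually_forall_mem_meanSpace hρ hμ hi)))
  have hKpos : (0 : ℝ) < K := by exact_mod_cast (by omega : 0 < K)
  obtain ⟨n₁, hn₁⟩ := eventually_atTop.1
    (eventually_rpow_add_one_le hα (η := 1 / (4 * K)) (by positivity))
  refine ⟨1 / (2 * K * (R + 1)), by positivity, n₁ + 4 * K * (n₀ + 1), by positivity,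
    fun s m T hrun N hN => ?_⟩
  have hN' : n₁ + 4 * K * (T + n₀) ≤ N := by
    calc n₁ + 4 * K * (T + n₀) ≤ n₁ * (T + 1) + 4 * K * ((n₀ + 1) * (T + 1)) :=
          Nat.add_le_add (Nat.le_mul_of_pos_right _ T.succ_pos)
            (Nat.mul_le_mul_left _ (by nlinarith))
      _ = (n₁ + 4 * K * (n₀ + 1)) * (T + 1) := by ring
      _ ≤ N := hN
  have hN1 : n₁ ≤ N := by omega
  have hN2 : 4 * K * (T + n₀) ≤ N := by omega
  have hN3 : T + n₀ ≤ N := (Nat.le_mul_of_pos_left _ (by omega)).trans hN2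
  have hN2' : 4 * (K : ℝ) * ((T + n₀ : ℕ) : ℝ) ≤ N := by exact_mod_cast hN2
  have hexp := hn₁ N hN1
  have hb : ∀ b, count s N b ≤ (R + 1) * count s N i + (T + n₀ : ℕ) + ((N : ℝ) ^ α + 1) := by
    intro b
    have hi0 := count_nonneg s N i
    have hRi := mul_nonneg hR hi0
    have hα0 : (0 : ℝ) ≤ (N : ℝ) ^ α := by positivity
    have hS0 : (0 : ℝ) ≤ ((T + n₀ : ℕ) : ℝ) := Nat.cast_nonneg _
    rcases eq_or_ne b i with rfl | hbi
    · linarith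
    rcases count_eq_or_exists_last s hN3 b with h | ⟨n, h1, h2, h3, h4⟩
    · have := count_le s (T + n₀) b
      linarith
    have hcl := hrun.close n (by omega)
    obtain ⟨hrat, hS⟩ := hn₀ n (by omega)
    obtain ⟨hmS, hmi⟩ := hS _ hcl
    have hmono := count_mono s i h2.le
    simp only at hmono
    rcases (hrun.rule n).cases hα₀ hmS hmi with h | ⟨hpos, h | ⟨-, hsum, -⟩⟩
    · have h5 : ((n : ℝ) + 1) ^ α ≤ (N : ℝ) ^ α :=
        Real.rpow_le_rpow (by positivity) (by exact_mod_cast h2) hα₀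
      rw [h3] at h
      linarith
    · exact absurd (h3.symm.trans h.1) hbi
    · have h5 := hrat _ _ hcl (fun a => div_nonneg (count_nonneg s n a) hpos.le) hsum b hbi
      rw [div_le_iff₀ hpos] at h5
      have := mul_le_mul_of_nonneg_left hmono hR
      linarith
  have hsum := Finset.sum_le_sum fun b (_ : b ∈ Finset.univ) => hb b
  rw [sum_count, Finset.sum_const, Finset.card_univ, Fintype.card_fin, nsmul_eq_mul] at hsum
  have h6 : (K : ℝ) * ((N : ℝ) ^ α + 1) ≤ N / 4 := by
    calc (K : ℝ) * ((N : ℝ) ^ α + 1) ≤ K * (1 / (4 * K) * N) := by gcongr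
      _ = N / 4 := by field_simp
  rw [div_mul_eq_mul_div, div_le_iff₀ (by positivity)]
  linarith

/-- A challenger is not pulled much beyond the balanced ratio, as one sees at the time of its last
pull. -/
lemma exists_count_le (hK : 2 ≤ K) (hρ : Nondegenerate ρ) (hμ : ∀ a, μ a ∈ meanSpace ρ)
    (hi : ∀ a, a ≠ i → μ a < μ i) (h : IsBalanced ρ μ i r w) (hα₀ : 0 ≤ α) (hα : α < 1)
    (hβ : 0 < β) (hβ₁ : β < 1) (hε : 0 < ε) :
    ∃ C, 0 ≤ C ∧ ∃ L : ℕ, 0 < L ∧ ∀ s m T, IsConcentrated v ρ μ α β ε s m T →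
      ∀ N, L * (T + 1) ≤ N → ∀ b, b ≠ i →
        count s N b ≤ r b * count s N i + C * (N : ℝ) ^ (1 - β) := by
  obtain ⟨c, hc, L, hL0, hL⟩ := exists_linear_le_count (v := v) hK hρ hμ hi hα₀ hα hβ hε
  -- The constant `1 / (c * ε)` absorbs the logarithmic bonus divided by `count s n i ≥ c * n`.
  obtain ⟨C, hC, hev⟩ := exists_challenger_ratio_le h hρ hμ hi (1 / (c * ε))
  obtain ⟨n₀, hn₀⟩ := eventually_atTop.1 (((tendsto_const_mul_rpow_neg hε hβ).eventually
    (hev.and (eventually_forall_mem_meanSpace hρ hμ hi))).and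
    (eventually_log_le_rpow (sub_pos.2 hβ₁)))
  have : Nonempty (Fin K) := ⟨i⟩
  -- Numbers of pulls below `r a₀ * c * N`, such as those from exploration, need no further bound.
  obtain ⟨a₀, ha₀⟩ := Finite.exists_min r
  have hη : 0 < r a₀ * c := mul_pos (h.pos a₀) hc
  obtain ⟨n₁, hn₁⟩ := eventually_atTop.1 (eventually_rpow_add_one_le hα hη)
  obtain ⟨M, hM⟩ := exists_nat_ge (1 / (r a₀ * c))
  rw [div_le_iff₀ hη] at hM
  refine ⟨C * ε + 1, by positivity, n₁ + (M + 1) * (L + n₀ + 1), by positivity,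
    fun s m T hrun N hN b hbi => ?_⟩
  set S := L * (T + 1) + n₀ + 1 with hS
  have hSle : S ≤ (L + n₀ + 1) * (T + 1) := by rw [hS]; nlinarith
  have hN' : n₁ + (M + 1) * S ≤ N := by
    calc n₁ + (M + 1) * S ≤ n₁ * (T + 1) + (M + 1) * ((L + n₀ + 1) * (T + 1)) :=
          Nat.add_le_add (Nat.le_mul_of_pos_right _ T.succ_pos) (Nat.mul_le_mul_left _ hSle)
      _ = (n₁ + (M + 1) * (L + n₀ + 1)) * (T + 1) := by ring
      _ ≤ N := hN
  have hN1 : n₁ ≤ N := by omega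
  have hN2 : M * S ≤ N := by nlinarith
  have hN3 : S ≤ N := by nlinarith
  have hN4 : L * (T + 1) ≤ N := by omega
  have hN5 : T ≤ S := by
    have : T + 1 ≤ L * (T + 1) := Nat.le_mul_of_pos_left _ hL0
    omega
  have hi0 := count_nonneg s N i
  have hlin := hL s m T hrun N hN4
  have hpow : (0 : ℝ) ≤ (N : ℝ) ^ (1 - β) := by positivity
  have hmain : r a₀ * c * N ≤ r b * count s N i := by
    rw [mul_assoc]
    exact mul_le_mul (ha₀ b) hlin (by positivity) (h.pos b).le
  have hCp : 0 ≤ (C * ε + 1) * (N : ℝ) ^ (1 - β) := by positivity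
  rcases count_eq_or_exists_last s hN3 b with h0 | ⟨n, h1, h2, h3, h4⟩
  · have h5 := count_le s S b
    have h6 : (M : ℝ) * S ≤ N := by exact_mod_cast hN2
    have h7 := mul_le_mul_of_nonneg_right hM (Nat.cast_nonneg (α := ℝ) S)
    have h8 := mul_le_mul_of_nonneg_left h6 hη.le
    linarith
  have hn0 : 0 < n := by omega
  have hcl := hrun.close n (by omega)
  obtain ⟨⟨hrat, hS⟩, hlog⟩ := hn₀ n (by omega)
  obtain ⟨hmS, hmi⟩ := hS _ hcl
  have hmono := count_mono s i h2.le
  simp only at hmono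
  rcases (hrun.rule n).cases hα₀ hmS hmi with h5 | ⟨hpos, h5 | ⟨-, hsum, hsc⟩⟩
  · have h6 : ((n : ℝ) + 1) ^ α ≤ (N : ℝ) ^ α :=
      Real.rpow_le_rpow (by positivity) (by exact_mod_cast h2) hα₀
    rw [h3] at h5
    linarith [hn₁ N hN1]
  · exact absurd (h3.symm.trans h5.1) hbi
  · rw [h3] at hsc
    have hnR : (0 : ℝ) < n := by exact_mod_cast hn0
    have h6 := hrat _ _ hcl (fun a => div_nonneg (count_nonneg s n a) hpos.le) hsum b hbi
      (fun a ha => (hsc a ha).trans (add_le_add_right ?_ _))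
    · rw [div_le_iff₀ hpos] at h6
      have h7 := rpow_neg_mul_le (β := β) hn0 (count_le s n i)
      have h8 : (n : ℝ) ^ (1 - β) ≤ (N : ℝ) ^ (1 - β) :=
        Real.rpow_le_rpow (by positivity) (by exact_mod_cast h2.le) (by linarith)
      have h9 : (1 : ℝ) ≤ (N : ℝ) ^ (1 - β) :=
        Real.one_le_rpow (by exact_mod_cast (by omega : 1 ≤ N)) (by linarith)
      have h10 := mul_le_mul_of_nonneg_left hmono (h.pos b).le
      have h11 := mul_le_mul_of_nonneg_left (h7.trans h8) (mul_nonneg hC hε.le)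
      linarith
    · -- The logarithmic bonus of the challengers is negligible as arm `i` is pulled linearly often.
      have hlin' := hL s m T hrun n (by omega)
      have h7 : Real.log (count s n a) ≤ (n : ℝ) ^ (1 - β) := by
        refine le_trans ?_ hlog
        rcases (count_nonneg s n a).eq_or_lt with h0 | h0
        · rw [← h0, Real.log_zero]
          exact Real.log_nonneg (by exact_mod_cast hn0)
        · exact Real.log_le_log h0 (count_le s n a)
      rw [div_le_iff₀ hpos]
      have h8 : (n : ℝ) ^ (1 - β) = (n : ℝ) ^ (-β) * n := by
        rw [← Real.rpow_add_one hnR.ne']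
        congr 1
        ring
      have h9 : 1 / (c * ε) * (ε * (n : ℝ) ^ (-β)) * count s n i
          = (n : ℝ) ^ (-β) * (count s n i / c) := by field_simp
      rw [h9]
      refine h7.trans (h8.le.trans (mul_le_mul_of_nonneg_left ?_ (by positivity)))
      rw [le_div_iff₀ hc, mul_comm]
      exact hlin'

/-- No challenger stays much below the balanced ratio, as one sees at the time of the last pull of
the best arm. -/
lemma exists_le_count (hK : 2 ≤ K) (hρ : Nondegenerate ρ) (hμ : ∀ a, μ a ∈ meanSpace ρ)
    (hi : ∀ a, a ≠ i → μ a < μ i) (h : IsBalanced ρ μ i r w) (hα₀ : 0 ≤ α) (hα : α < 1)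
    (hβ : 0 < β) (hβ₁ : β < 1) (hε : 0 < ε) :
    ∃ C, 0 ≤ C ∧ ∃ L : ℕ, 0 < L ∧ ∀ s m T, IsConcentrated v ρ μ α β ε s m T →
      ∀ N, L * (T + 1) ≤ N → ∀ b, b ≠ i →
        r b * count s N i - C * (N : ℝ) ^ (1 - β) ≤ count s N b := by
  obtain ⟨c, hc, L₁, hL₁0, hL₁⟩ := exists_linear_le_count (v := v) hK hρ hμ hi hα₀ hα hβ hε
  obtain ⟨C₂, hC₂, L₂, hL₂0, hL₂⟩ := exists_count_le (v := v) hK hρ hμ hi h hα₀ hα hβ hβ₁ hε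
  obtain ⟨C, hC, hev⟩ := exists_le_ratio_of_leader h hρ hμ hi
    (A := C₂ / (c * ε)) (by positivity)
  obtain ⟨n₀, hn₀⟩ := eventually_atTop.1 ((tendsto_const_mul_rpow_neg hε hβ).eventually
    (hev.and (eventually_forall_mem_meanSpace hρ hμ hi)))
  obtain ⟨n₁, hn₁⟩ := eventually_atTop.1 (eventually_rpow_add_one_le hα (half_pos hc))
  obtain ⟨M, hM⟩ := exists_nat_gt (1 / c)
  rw [div_lt_iff₀ hc] at hM
  have hZ : 0 < ∑ a, r a := h.sum_pos
  refine ⟨C * ε + ∑ a, r a, by positivity, n₁ + (M + 1) * (L₁ + L₂ + n₀ + 1), by positivity,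
    fun s m T hrun N hN b hbi => ?_⟩
  set S := (L₁ + L₂) * (T + 1) + n₀ + 1 with hS
  have hSle : S ≤ (L₁ + L₂ + n₀ + 1) * (T + 1) := by rw [hS]; nlinarith
  have hN' : n₁ + (M + 1) * S ≤ N := by
    calc n₁ + (M + 1) * S ≤ n₁ * (T + 1) + (M + 1) * ((L₁ + L₂ + n₀ + 1) * (T + 1)) :=
          Nat.add_le_add (Nat.le_mul_of_pos_right _ T.succ_pos) (Nat.mul_le_mul_left _ hSle)
      _ = (n₁ + (M + 1) * (L₁ + L₂ + n₀ + 1)) * (T + 1) := by ring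
      _ ≤ N := hN
  have hSpos : 0 < S := by omega
  have hS1 : L₁ * (T + 1) ≤ S := by rw [hS]; nlinarith
  have hS2 : L₂ * (T + 1) ≤ S := by rw [hS]; nlinarith
  have hN1 : n₁ ≤ N := by omega
  have hN2 : M * S ≤ N := by nlinarith
  have hN3 : S ≤ N := by nlinarith
  have hN5 : T ≤ S := by
    have : T + 1 ≤ L₁ * (T + 1) := Nat.le_mul_of_pos_left _ hL₁0
    omega
  have hlin := hL₁ s m T hrun N (by omega)
  have hNpos : (0 : ℝ) < N := by exact_mod_cast (by omega : 0 < N)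
  rcases count_eq_or_exists_last s hN3 i with h0 | ⟨n, h1, h2, h3, h4⟩
  · exfalso
    have h5 := count_le s S i
    have h6 : (M : ℝ) * S ≤ N := by exact_mod_cast hN2
    have hSR : (0 : ℝ) < S := by exact_mod_cast hSpos
    have h7 := mul_lt_mul_of_pos_right hM hSR
    have h8 := mul_le_mul_of_nonneg_left h6 hc.le
    linarith
  have hn0 : 0 < n := by omega
  have hcl := hrun.close n (by omega)
  obtain ⟨hrat, hS⟩ := hn₀ n (by omega)
  obtain ⟨hmS, hmi⟩ := hS _ hcl
  rcases (hrun.rule n).cases hα₀ hmS hmi with h5 | ⟨hpos, ⟨-, hsum⟩ | ⟨h5, -, -⟩⟩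
  · exfalso
    have h6 : ((n : ℝ) + 1) ^ α ≤ (N : ℝ) ^ α :=
      Real.rpow_le_rpow (by positivity) (by exact_mod_cast h2) hα₀
    rw [h3] at h5
    have := hn₁ N hN1
    have := mul_pos hc hNpos
    linarith
  · have hnR : (0 : ℝ) < n := by exact_mod_cast hn0
    have hlin' := hL₁ s m T hrun n (by omega)
    have h6 := hrat _ _ hcl (fun a => div_nonneg (count_nonneg s n a) hpos.le)
      (fun a ha => ?_) hsum b hbi
    · rw [le_div_iff₀ hpos] at h6
      have h7 := rpow_neg_mul_le (β := β) hn0 (count_le s n i)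
      have h8 : (n : ℝ) ^ (1 - β) ≤ (N : ℝ) ^ (1 - β) :=
        Real.rpow_le_rpow (by positivity) (by exact_mod_cast h2.le) (by linarith)
      have h9 : (1 : ℝ) ≤ (N : ℝ) ^ (1 - β) :=
        Real.one_le_rpow (by exact_mod_cast (by omega : 1 ≤ N)) (by linarith)
      have h10 := count_mono s b h2.le
      have h11 := mul_le_mul_of_nonneg_left (h7.trans h8) (mul_nonneg hC hε.le)
      have h12 : r b ≤ ∑ a, r a :=
        Finset.single_le_sum (fun a _ => (h.pos a).le) (Finset.mem_univ b)
      have h13 := mul_le_mul_of_nonneg_left h9 hZ.le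
      simp only at h10
      have h14 : r b * count s N i = r b * count s n i + r b := by rw [h4]; ring
      linarith
    · have h7 := hL₂ s m T hrun n (by omega) a ha
      rw [div_le_iff₀ hpos]
      have h8 : (n : ℝ) ^ (1 - β) = (n : ℝ) ^ (-β) * n := by
        rw [← Real.rpow_add_one hnR.ne']
        congr 1
        ring
      have h9 : C₂ / (c * ε) * (ε * (n : ℝ) ^ (-β)) * count s n i
          = C₂ * ((n : ℝ) ^ (-β) * (count s n i / c)) := by field_simp
      rw [add_mul, h9]
      refine h7.trans (add_le_add_right (mul_le_mul_of_nonneg_left ?_ hC₂) _)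
      rw [h8]
      refine mul_le_mul_of_nonneg_left ?_ (by positivity)
      rw [le_div_iff₀ hc, mul_comm]
      exact hlin'
  · exact absurd h3 h5

/-- The bounds on the numbers of pulls relative to that of the best arm give the proportions, as the
numbers of pulls add up to `N`. -/
lemma exists_abs_count_div_sub_le (hK : 2 ≤ K) (hρ : Nondegenerate ρ)
    (hμ : ∀ a, μ a ∈ meanSpace ρ) (hi : ∀ a, a ≠ i → μ a < μ i) (h : IsBalanced ρ μ i r w)
    (hα₀ : 0 ≤ α) (hα : α < 1) (hβ : 0 < β) (hβ₁ : β < 1) (hε : 0 < ε) :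
    ∃ C, 0 < C ∧ ∃ L : ℕ, 0 < L ∧ ∀ s m T, IsConcentrated v ρ μ α β ε s m T →
      ∀ N, L * (T + 1) ≤ N → ∀ a, |count s N a / N - allocation r a| ≤ C * (N : ℝ) ^ (-β) := by
  obtain ⟨C₁, hC₁, L₁, hL₁0, hL₁⟩ := exists_count_le (v := v) hK hρ hμ hi h hα₀ hα hβ hβ₁ hε
  obtain ⟨C₂, hC₂, L₂, hL₂0, hL₂⟩ := exists_le_count (v := v) hK hρ hμ hi h hα₀ hα hβ hβ₁ hε
  refine ⟨(C₁ + C₂) * (1 + K) + 1, by positivity, L₁ + L₂, by omega,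
    fun s m T hrun N hN a => ?_⟩
  rw [add_mul] at hN
  have hNpos : (0 : ℝ) < N := by
    have : 0 < L₁ * (T + 1) := by positivity
    exact_mod_cast (by omega : 0 < N)
  have hx : (N : ℝ) ^ (1 - β) = (N : ℝ) ^ (-β) * N := by
    rw [← Real.rpow_add_one hNpos.ne']
    congr 1
    ring
  have hx0 : 0 < (N : ℝ) ^ (-β) := by positivity
  set x := (N : ℝ) ^ (1 - β)
  have hxpos : 0 ≤ x := by positivity
  set E := (C₁ + C₂) * x with hE
  have hE0 : 0 ≤ E := by positivity
  have hb : ∀ b, |count s N b - r b * count s N i| ≤ E := by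
    intro b
    rcases eq_or_ne b i with rfl | hbi
    · rw [h.leader, one_mul, sub_self, abs_zero]
      exact hE0
    have e1 := hL₁ s m T hrun N (by omega) b hbi
    have e2 := hL₂ s m T hrun N (by omega) b hbi
    have e3 := mul_nonneg hC₁ hxpos
    have e4 := mul_nonneg hC₂ hxpos
    rw [abs_le]
    constructor <;> rw [hE] <;> linarith
  set Z := ∑ b, r b with hZ
  have hZpos : 0 < Z := h.sum_pos
  have hsum : |(N : ℝ) - Z * count s N i| ≤ K * E := by
    calc |(N : ℝ) - Z * count s N i| = |∑ b, (count s N b - r b * count s N i)| := by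
          rw [Finset.sum_sub_distrib, sum_count, ← Finset.sum_mul]
      _ ≤ ∑ b, |count s N b - r b * count s N i| := Finset.abs_sum_le_sum_abs _ _
      _ ≤ ∑ b : Fin K, E := Finset.sum_le_sum fun b _ => hb b
      _ = K * E := by simp
  have hra : r a / Z ≤ 1 := by
    rw [div_le_one hZpos]
    exact Finset.single_le_sum (fun a _ => (h.pos a).le) (Finset.mem_univ a)
  have hra0 : 0 ≤ r a / Z := (div_pos (h.pos a) hZpos).le
  have hdec : count s N a / N - allocation r a = ((count s N a - r a * count s N i)
      - r a / Z * ((N : ℝ) - Z * count s N i)) / N := by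
    rw [allocation, ← hZ]
    field_simp
    ring
  rw [hdec, abs_div, abs_of_pos hNpos, div_le_iff₀ hNpos]
  calc |(count s N a - r a * count s N i) - r a / Z * ((N : ℝ) - Z * count s N i)|
      ≤ |count s N a - r a * count s N i| + |r a / Z * ((N : ℝ) - Z * count s N i)| :=
        abs_sub _ _
    _ ≤ E + 1 * (K * E) := by
        rw [abs_mul, abs_of_nonneg hra0]
        gcongr
        exact hb a
    _ = (C₁ + C₂) * (1 + K) * x := by rw [hE]; ring
    _ ≤ ((C₁ + C₂) * (1 + K) + 1) * x := by gcongr; linarith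
    _ = ((C₁ + C₂) * (1 + K) + 1) * (N : ℝ) ^ (-β) * N := by rw [hx]; ring

/-! ### The effect of exploration -/

/-- Every arm is pulled at least `(N / 2) ^ α` times: otherwise all pulls in the second half of the
first `N` iterations are explorations of arms pulled fewer than `(N / 2) ^ α` times. -/
lemma exists_rpow_le_count (hK : 2 ≤ K) (hα₀ : 0 ≤ α) (hα : α < 1) :
    ∃ n₀ : ℕ, ∀ (s : ℕ → Fin K) (m : ℕ → Fin K → ℝ),
      (∀ n, IsChoice v ρ α n (count s n) (m n) (s n)) →
      ∀ N, n₀ ≤ N → ∀ a, ((N : ℝ) / 2) ^ α ≤ count s N a := by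
  have hKpos : (0 : ℝ) < K := by exact_mod_cast (by omega : 0 < K)
  obtain ⟨n₁, hn₁⟩ := eventually_atTop.1
    (eventually_rpow_add_one_le hα (η := 1 / (4 * K)) (by positivity))
  refine ⟨n₁ + 3, fun s m hrule N hN a => ?_⟩
  by_contra! hlt
  set S := (N + 1) / 2 with hS
  have hSN : S ≤ N := by omega
  have hS1 : (N : ℝ) / 2 ≤ S := by
    have : N ≤ 2 * S := by omega
    have : (N : ℝ) ≤ 2 * S := by exact_mod_cast this
    linarith
  have hS2 : (S : ℝ) ≤ N / 2 + 1 / 2 := by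
    have : 2 * S ≤ N + 1 := by omega
    have : 2 * (S : ℝ) ≤ N + 1 := by exact_mod_cast this
    linarith
  have hb : ∀ b, count s N b ≤ count s S b + ((N : ℝ) ^ α + 1) := by
    intro b
    have hS0 := count_nonneg s S b
    have hα0 : (0 : ℝ) ≤ (N : ℝ) ^ α := by positivity
    rcases count_eq_or_exists_last s hSN b with h | ⟨n, h1, h2, h3, h4⟩
    · linarith
    have hmono := count_mono s a h2.le
    simp only at hmono
    have h5 : ((N : ℝ) / 2) ^ α ≤ ((n : ℝ) + 1) ^ α := by
      refine Real.rpow_le_rpow (by positivity) ?_ hα₀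
      have : (S : ℝ) ≤ n := by exact_mod_cast h1
      linarith
    have h6 := (hrule n).1 ⟨a, by linarith⟩ a
    rw [h3] at h6
    have h7 : ((N : ℝ) / 2) ^ α ≤ (N : ℝ) ^ α :=
      Real.rpow_le_rpow (by positivity) (by linarith [Nat.cast_nonneg (α := ℝ) N]) hα₀
    linarith
  have hsum := Finset.sum_le_sum fun b (_ : b ∈ Finset.univ) => hb b
  rw [sum_count, Finset.sum_add_distrib, sum_count, Finset.sum_const, Finset.card_univ,
    Fintype.card_fin, nsmul_eq_mul] at hsum
  have h6 : (K : ℝ) * ((N : ℝ) ^ α + 1) ≤ N / 4 := by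
    calc (K : ℝ) * ((N : ℝ) ^ α + 1) ≤ K * (1 / (4 * K) * N) := by
          gcongr
          exact hn₁ N (by omega)
      _ = N / 4 := by field_simp
  have h7 : (3 : ℝ) ≤ N := by exact_mod_cast (by omega : 3 ≤ N)
  linarith

end Trajectory

/-! ### Concentration of the empirical means -/

section Concentration

variable {K : ℕ} {v : Variant} {ρ : Measure ℝ} {μ : Fin K → ℝ} {α : ℝ} {Ω : Type*}
  {A : ℕ → Ω → Fin K} {X : ℕ → Ω → ℝ}

/-- The sum of the rewards of arm `a` in the first `n` iterations, each centred at `c`. -/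
noncomputable def centredSum (A : ℕ → Ω → Fin K) (X : ℕ → Ω → ℝ) (a : Fin K) (c : ℝ) (n : ℕ)
    (ω : Ω) : ℝ :=
  ∑ k ∈ Finset.range n, if A k ω = a then X k ω - c else 0

lemma pulls_succ (n : ℕ) (ω : Ω) (a : Fin K) :
    pulls A (n + 1) ω a = pulls A n ω a + if A n ω = a then 1 else 0 :=
  count_succ (fun k => A k ω) n a

lemma centredSum_succ (a : Fin K) (c : ℝ) (n : ℕ) (ω : Ω) :
    centredSum A X a c (n + 1) ω
      = centredSum A X a c n ω + if A n ω = a then X n ω - c else 0 :=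
  Finset.sum_range_succ _ _

lemma empMean_sub_mul_pulls (a : Fin K) (c : ℝ) {n : ℕ} {ω : Ω} (h : 0 < pulls A n ω a) :
    (empMean A X n ω a - c) * pulls A n ω a = centredSum A X a c n ω := by
  rw [sub_mul, empMean, div_mul_cancel₀ _ h.ne', centredSum, ← Finset.sum_filter,
    Finset.sum_sub_distrib, Finset.sum_const, nsmul_eq_mul, pulls, mul_comm c]

variable [mΩ : MeasurableSpace Ω] {P : Measure Ω} {𝓕 : Filtration ℕ mΩ}

namespace IsRun

variable (h : IsRun v ρ μ α P 𝓕 A X)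
include h

lemma measurableSet_arm (n : ℕ) (a : Fin K) : MeasurableSet[𝓕 n] {ω | A n ω = a} :=
  h.measurable_arm n (measurableSet_singleton a)

lemma measurable_pulls (n : ℕ) (a : Fin K) : Measurable[𝓕 n] (fun ω => pulls A n ω a) := by
  induction n with
  | zero =>
    have : (fun ω => pulls A 0 ω a) = fun _ => 0 := funext fun ω => count_zero _ a
    rw [this]
    exact @measurable_const _ _ _ (𝓕 0) _
  | succ n ih =>
    simp_rw [pulls_succ]
    have hle := 𝓕.mono n.le_succ
    exact (ih.mono hle le_rfl).add (Measurable.ite (hle _ (h.measurableSet_arm n a))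
      measurable_const measurable_const)

lemma measurable_centredSum (a : Fin K) (c : ℝ) (n : ℕ) :
    Measurable[𝓕 n] (centredSum A X a c n) := by
  induction n with
  | zero =>
    have : centredSum A X a c 0 = fun _ => 0 := funext fun ω => by simp [centredSum]
    rw [this]
    exact @measurable_const _ _ _ (𝓕 0) _
  | succ n ih =>
    have : centredSum A X a c (n + 1) = fun ω =>
        centredSum A X a c n ω + if A n ω = a then X n ω - c else 0 :=
      funext fun ω => centredSum_succ a c n ω
    rw [this]
    have hle := 𝓕.mono n.le_succ
    exact (ih.mono hle le_rfl).add (Measurable.ite (hle _ (h.measurableSet_arm n a))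
      ((h.measurable_reward n).sub_const c) measurable_const)

lemma measurable_reward' (n : ℕ) : Measurable (X n) :=
  (h.measurable_reward n).mono (𝓕.le _) le_rfl

/-- On the event that arm `a` is pulled, the reward is independent of the past and has the law of
arm `a`. -/
lemma setLIntegral_mul_comp_reward (n : ℕ) (a : Fin K) {g : Ω → ℝ≥0∞}
    (hg : Measurable[𝓕 n] g) {f : ℝ → ℝ≥0∞} (hf : Measurable f) :
    ∫⁻ ω in {ω | A n ω = a}, g ω * f (X n ω) ∂P
      = (∫⁻ ω in {ω | A n ω = a}, g ω ∂P) * ∫⁻ x, f x ∂(armLaw ρ (μ a)) := by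
  set E := {ω | A n ω = a} with hE
  have hEm : MeasurableSet[𝓕 n] E := h.measurableSet_arm n a
  have hX := h.measurable_reward' n
  have hg' : Measurable g := hg.mono (𝓕.le n) le_rfl
  refine Measurable.ennreal_induction (motive := fun f : ℝ → ℝ≥0∞ => ∫⁻ ω in E, g ω * f (X n ω) ∂P
    = (∫⁻ ω in E, g ω ∂P) * ∫⁻ x, f x ∂(armLaw ρ (μ a))) ?_ ?_ ?_ hf
  · intro c B hB
    have htrim : (P.restrict (E ∩ X n ⁻¹' B)).trim (𝓕.le n)
        = armLaw ρ (μ a) B • (P.restrict E).trim (𝓕.le n) := by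
      refine @Measure.ext _ (𝓕 n) _ _ fun t ht => ?_
      rw [Measure.smul_apply, trim_measurableSet_eq _ ht, trim_measurableSet_eq _ ht,
        Measure.restrict_apply (𝓕.le n _ ht), Measure.restrict_apply (𝓕.le n _ ht),
        ← inter_assoc, smul_eq_mul, mul_comm]
      exact h.reward_law n a (t ∩ E) (ht.inter hEm) (fun ω hω => hω.2) B hB
    have h1 : ∫⁻ ω in E ∩ X n ⁻¹' B, g ω ∂P = armLaw ρ (μ a) B * ∫⁻ ω in E, g ω ∂P := by
      rw [← lintegral_trim (𝓕.le n) hg, htrim, lintegral_smul_measure, lintegral_trim (𝓕.le n) hg,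
        smul_eq_mul]
    have h2 : ∀ ω, g ω * B.indicator (fun _ => c) (X n ω)
        = (X n ⁻¹' B).indicator (fun ω => g ω * c) ω := by
      intro ω
      by_cases hω : X n ω ∈ B <;> simp [hω]
    simp_rw [h2]
    rw [lintegral_indicator (hX hB), Measure.restrict_restrict (hX hB), inter_comm,
      lintegral_mul_const _ hg', h1, lintegral_indicator_const hB]
    ring
  · intro f₁ f₂ _ hf₁ hf₂ ih₁ ih₂
    simp only [Pi.add_apply, mul_add]
    have hm : Measurable fun ω => g ω * f₁ (X n ω) := hg'.mul (hf₁.comp hX)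
    rw [lintegral_add_left hm, ih₁, ih₂, lintegral_add_left hf₁, mul_add]
  · intro f hf hmono ih
    simp only [ENNReal.mul_iSup]
    have hm : ∀ k, Measurable fun ω => g ω * f k (X n ω) := fun k => hg'.mul ((hf k).comp hX)
    rw [lintegral_iSup hm
      (fun k l hkl ω => mul_le_mul_right (hmono hkl _) _), lintegral_iSup hf hmono,
      ENNReal.mul_iSup]
    simp_rw [ih]

/-- The exponential supermartingale of an arm. -/
lemma lintegral_exp_centredSum_le [IsProbabilityMeasure P] (a : Fin K) {t κ : ℝ}
    (hκ : ∫⁻ x, ENNReal.ofReal (Real.exp (t * (x - μ a))) ∂(armLaw ρ (μ a))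
      ≤ ENNReal.ofReal (Real.exp κ)) (n : ℕ) :
    ∫⁻ ω, ENNReal.ofReal (Real.exp (t * centredSum A X a (μ a) n ω - κ * pulls A n ω a)) ∂P
      ≤ 1 := by
  induction n with
  | zero =>
    have : ∀ ω, pulls A 0 ω a = 0 := fun ω => count_zero _ a
    simp [centredSum, this]
  | succ n ih =>
    set M : ℕ → Ω → ℝ≥0∞ := fun n ω =>
      ENNReal.ofReal (Real.exp (t * centredSum A X a (μ a) n ω - κ * pulls A n ω a)) with hM
    change ∫⁻ ω, M (n + 1) ω ∂P ≤ 1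
    refine le_trans ?_ ih
    change _ ≤ ∫⁻ ω, M n ω ∂P
    have hMm : Measurable[𝓕 n] (M n) :=
      (Real.measurable_exp.comp (((h.measurable_centredSum a (μ a) n).const_mul t).sub
        ((h.measurable_pulls n a).const_mul κ))).ennreal_ofReal
    set E := {ω | A n ω = a} with hE
    have hEm : MeasurableSet E := 𝓕.le n _ (h.measurableSet_arm n a)
    set f : ℝ → ℝ≥0∞ := fun x =>
      ENNReal.ofReal (Real.exp (-κ)) * ENNReal.ofReal (Real.exp (t * (x - μ a))) with hf
    have hfm : Measurable f := by fun_prop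
    have hfi : ∫⁻ x, f x ∂(armLaw ρ (μ a)) ≤ 1 := by
      rw [hf, lintegral_const_mul _ (by fun_prop)]
      refine (mul_le_mul_right hκ _).trans ?_
      rw [← ENNReal.ofReal_mul (by positivity), ← Real.exp_add]
      simp
    rw [← lintegral_add_compl _ hEm, ← lintegral_add_compl (M n) hEm]
    refine add_le_add ?_ ?_
    · have h1 : ∫⁻ ω in E, M (n + 1) ω ∂P = ∫⁻ ω in E, M n ω * f (X n ω) ∂P := by
        refine setLIntegral_congr_fun hEm fun ω hω => ?_
        have hω : A n ω = a := hω
        simp only [hM, hf, centredSum_succ, pulls_succ, if_pos hω]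
        rw [← ENNReal.ofReal_mul (by positivity), ← ENNReal.ofReal_mul (by positivity),
          ← Real.exp_add, ← Real.exp_add]
        congr 2
        ring
      rw [h1, h.setLIntegral_mul_comp_reward n a hMm hfm]
      exact mul_le_of_le_one_right (zero_le) hfi
    · refine le_of_eq (setLIntegral_congr_fun hEm.compl fun ω hω => ?_)
      have hω : A n ω ≠ a := hω
      simp only [hM, centredSum_succ, pulls_succ, if_neg hω, add_zero]

/-- Chernoff's bound for the deviations of an arm that has been pulled at least `k` times; the sign
of `t` selects the side. -/
lemma measure_centredSum_ge_le [IsProbabilityMeasure P] (a : Fin K) {t κ x k : ℝ}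
    (hκ : ∫⁻ x, ENNReal.ofReal (Real.exp (t * (x - μ a))) ∂(armLaw ρ (μ a))
      ≤ ENNReal.ofReal (Real.exp κ)) (hx : κ ≤ x) (n : ℕ) :
    P {ω | k ≤ pulls A n ω a ∧ x * pulls A n ω a ≤ t * centredSum A X a (μ a) n ω}
      ≤ ENNReal.ofReal (Real.exp (-((x - κ) * k))) := by
  set M : Ω → ℝ≥0∞ := fun ω =>
    ENNReal.ofReal (Real.exp (t * centredSum A X a (μ a) n ω - κ * pulls A n ω a)) with hM
  have hMm : Measurable M :=
    ((Real.measurable_exp.comp (((h.measurable_centredSum a (μ a) n).const_mul t).sub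
      ((h.measurable_pulls n a).const_mul κ))).ennreal_ofReal).mono (𝓕.le n) le_rfl
  set L := ENNReal.ofReal (Real.exp ((x - κ) * k)) with hL
  have hsub : {ω | k ≤ pulls A n ω a ∧ x * pulls A n ω a ≤ t * centredSum A X a (μ a) n ω}
      ⊆ {ω | L ≤ M ω} := by
    rintro ω ⟨h1, h2⟩
    refine ENNReal.ofReal_le_ofReal (Real.exp_le_exp.2 ?_)
    have := mul_le_mul_of_nonneg_left h1 (sub_nonneg.2 hx)
    linarith
  have hmarkov := (mul_meas_ge_le_lintegral (μ := P) hMm L).trans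
    (h.lintegral_exp_centredSum_le a hκ n)
  rw [Real.exp_neg, ENNReal.ofReal_inv_of_pos (Real.exp_pos _), ENNReal.le_inv_iff_mul_le, mul_comm]
  exact (mul_le_mul_right (measure_mono hsub) _).trans hmarkov

/-- Deviations of size `ε * n ^ (-3 * α / 8)` of the empirical mean of an arm have stretched
exponential tails, since exploration provides `(n / 2) ^ α` samples. -/
lemma exists_measure_empMean_le [IsProbabilityMeasure P] (hK : 2 ≤ K) (hρ : Nondegenerate ρ)
    (hμ : ∀ a, μ a ∈ meanSpace ρ) (hα₀ : 0 < α) (hα : α < 1) {ε : ℝ} (hε : 0 < ε) (a : Fin K) :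
    ∃ c, 0 < c ∧ ∀ᶠ n : ℕ in atTop,
      P {ω | ε * (n : ℝ) ^ (-(3 * α / 8)) < |empMean A X n ω a - μ a|}
        ≤ ENNReal.ofReal (2 * Real.exp (-(c * (n : ℝ) ^ (α / 4)))) := by
  obtain ⟨C, hC, hmgf⟩ := exists_lintegral_exp_armLaw_le hρ (hμ a)
  obtain ⟨n₀, hn₀⟩ := exists_rpow_le_count (v := v) (ρ := ρ) hK hα₀.le hα
  refine ⟨ε ^ 2 / (4 * C) * (1 / 2) ^ α, by positivity, ?_⟩
  have hlim : Tendsto (fun n : ℕ => ε / (2 * C) * (n : ℝ) ^ (-(3 * α / 8))) atTop (𝓝[>] 0) :=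
    tendsto_const_mul_rpow_neg (by positivity) (by positivity)
  have hlim1 := (hlim.mono_right nhdsWithin_le_nhds).eventually hmgf
  have hlim2 : ∀ᶠ n : ℕ in atTop, ∫⁻ x, ENNReal.ofReal
      (Real.exp (-(ε / (2 * C) * (n : ℝ) ^ (-(3 * α / 8))) * (x - μ a))) ∂(armLaw ρ (μ a))
      ≤ ENNReal.ofReal (Real.exp (C * (-(ε / (2 * C) * (n : ℝ) ^ (-(3 * α / 8)))) ^ 2)) := by
    have := (hlim.mono_right nhdsWithin_le_nhds).neg
    rw [neg_zero] at this
    exact this.eventually hmgf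
  filter_upwards [hlim1, hlim2, eventually_ge_atTop n₀, eventually_gt_atTop 0]
    with n h1 h2 hn hn0
  have hnR : (0 : ℝ) < n := by exact_mod_cast hn0
  set y := (n : ℝ) ^ (-(3 * α / 8)) with hy
  have hy0 : 0 < y := by positivity
  -- The Chernoff parameter `τ` minimises `C * τ ^ 2 - τ * (ε * y)`.
  set τ := ε / (2 * C) * y with hτ
  have hτ0 : 0 < τ := by positivity
  rw [neg_sq] at h2
  set k := ((n : ℝ) / 2) ^ α with hk
  have hk0 : 0 < k := by positivity
  have hκ : C * τ ^ 2 ≤ τ * (ε * y) := by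
    have h3 : τ * (ε * y) = 2 * (C * τ ^ 2) := by rw [hτ]; field_simp
    have : 0 ≤ C * τ ^ 2 := by positivity
    linarith
  have hexp : (τ * (ε * y) - C * τ ^ 2) * k
      = ε ^ 2 / (4 * C) * (1 / 2) ^ α * (n : ℝ) ^ (α / 4) := by
    have h3 : (n : ℝ) ^ (α / 4) = y ^ 2 * (n : ℝ) ^ α := by
      rw [hy, ← Real.rpow_natCast, ← Real.rpow_mul hnR.le, ← Real.rpow_add hnR]
      congr 1
      push_cast
      ring
    rw [h3, hk, div_eq_mul_one_div (n : ℝ) 2, Real.mul_rpow hnR.le (by norm_num), hτ]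
    field_simp
    ring
  have hb1 := h.measure_centredSum_ge_le (k := k) a h1 hκ n
  have hb2 := h.measure_centredSum_ge_le (k := k) a h2 hκ n
  rw [hexp] at hb1 hb2
  have hsub : {ω | ε * y < |empMean A X n ω a - μ a|}
      ⊆ {ω | k ≤ pulls A n ω a ∧
          τ * (ε * y) * pulls A n ω a ≤ τ * centredSum A X a (μ a) n ω} ∪
        {ω | k ≤ pulls A n ω a ∧
          τ * (ε * y) * pulls A n ω a ≤ -τ * centredSum A X a (μ a) n ω} := by
    intro ω hω
    have hω : ε * y < |empMean A X n ω a - μ a| := hω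
    have hcount : k ≤ pulls A n ω a :=
      hn₀ (fun j => A j ω) (fun j => empMean A X j ω) (fun j => h.rule j ω) n hn a
    have hp : 0 < pulls A n ω a := hk0.trans_le hcount
    have hs := empMean_sub_mul_pulls (A := A) (X := X) a (μ a) hp
    rcases lt_abs.1 hω with h3 | h3
    · refine Or.inl ⟨hcount, ?_⟩
      rw [← hs, mul_assoc]
      gcongr
    · refine Or.inr ⟨hcount, ?_⟩
      rw [← hs, neg_mul, ← mul_neg, ← neg_mul, mul_assoc]
      gcongr
  refine (measure_mono hsub).trans ((measure_union_le _ _).trans ?_)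
  rw [two_mul, ENNReal.ofReal_add (by positivity) (by positivity)]
  exact add_le_add hb1 hb2

lemma measurableSet_deviation (n : ℕ) (a : Fin K) (x : ℝ) :
    MeasurableSet {ω | x < |empMean A X n ω a - μ a|} := by
  have h1 : Measurable (fun ω => empMean A X n ω a) := by
    have h2 : (fun ω => empMean A X n ω a)
        = fun ω => centredSum A X a 0 n ω / pulls A n ω a := by
      funext ω
      simp only [empMean, centredSum, sub_zero, Finset.sum_filter]
    rw [h2]
    exact ((h.measurable_centredSum a 0 n).mono (𝓕.le n) le_rfl).div
      ((h.measurable_pulls n a).mono (𝓕.le n) le_rfl)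
  exact measurableSet_lt measurable_const (h1.sub_const _).abs

end IsRun

lemma summable_mul_exp_neg_rpow {c γ : ℝ} (hc : 0 < c) (hγ : 0 < γ) :
    Summable (fun n : ℕ => ((n : ℝ) + 1) * Real.exp (-(c * (n : ℝ) ^ γ))) := by
  have h1 := (isLittleO_exp_neg_mul_rpow_atTop hc (-(3 / γ))).isBigO
  have h2 : Tendsto (fun n : ℕ => (n : ℝ) ^ γ) atTop atTop :=
    (tendsto_rpow_atTop hγ).comp tendsto_natCast_atTop_atTop
  obtain ⟨B, hB⟩ := (h1.comp_tendsto h2).bound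
  refine summable_of_isBigO_nat (Real.summable_nat_pow_inv.2 one_lt_two)
    (Asymptotics.IsBigO.of_bound (2 * B) ?_)
  filter_upwards [hB, eventually_gt_atTop 0] with n hn hn0
  have hn1 : (1 : ℝ) ≤ n := by exact_mod_cast hn0
  have hnR : (0 : ℝ) < n := by linarith
  simp only [Function.comp, Real.norm_eq_abs, Real.abs_exp] at hn
  rw [← Real.rpow_mul hnR.le, show γ * -(3 / γ) = -3 by field_simp, abs_of_pos (by positivity),
    neg_mul] at hn
  rw [Real.norm_eq_abs, Real.norm_eq_abs, abs_of_pos (by positivity), abs_of_pos (by positivity)]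
  have h3 : (n : ℝ) ^ (-3 : ℝ) = (n : ℝ) ^ (-1 : ℝ) * ((n : ℝ) ^ 2)⁻¹ := by
    rw [← Real.rpow_natCast, ← Real.rpow_neg hnR.le, ← Real.rpow_add hnR]
    norm_num
  calc ((n : ℝ) + 1) * Real.exp (-(c * (n : ℝ) ^ γ))
      ≤ (2 * n) * (B * (n : ℝ) ^ (-3 : ℝ)) := by gcongr; linarith
    _ = 2 * B * ((n : ℝ) ^ 2)⁻¹ := by
        rw [h3, Real.rpow_neg_one]
        field_simp

/-- A time with finite mean after which none of the events `B n` occurs, provided that the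
probabilities of these events decay quickly: a multiple of the sum of `n + 1` over the events that
occur will do. -/
lemma exists_integrable_time [IsProbabilityMeasure P] {ι : Type*} [Fintype ι]
    {B : ι → ℕ → Set Ω} (hB : ∀ a n, MeasurableSet (B a n)) {γ : ℝ} (hγ : 0 < γ)
    (hP : ∀ a, ∃ c, 0 < c ∧ ∀ᶠ n : ℕ in atTop,
      P (B a n) ≤ ENNReal.ofReal (2 * Real.exp (-(c * (n : ℝ) ^ γ)))) :
    ∃ T : Ω → ℕ, Measurable T ∧ Integrable (fun ω => (T ω : ℝ)) P ∧
      ∀ᵐ ω ∂P, ∀ n, T ω ≤ n → ∀ a, ω ∉ B a n := by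
  set S : Ω → ℝ≥0∞ := fun ω => ∑ a, ∑' n, (B a n).indicator (fun _ => ((n + 1 : ℕ) : ℝ≥0∞)) ω
    with hS
  have hSm : Measurable S := Finset.measurable_sum _ fun a _ =>
    Measurable.tsum fun n => measurable_const.indicator (hB a n)
  have hSi : ∫⁻ ω, S ω ∂P ≠ ∞ := by
    rw [hS, lintegral_finsetSum _ fun a _ =>
      Measurable.tsum fun n => measurable_const.indicator (hB a n)]
    refine ENNReal.sum_ne_top.2 fun a _ => ?_
    rw [lintegral_tsum fun n => (measurable_const.indicator (hB a n)).aemeasurable]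
    obtain ⟨c, hc, hev⟩ := hP a
    obtain ⟨n₀, hn₀⟩ := eventually_atTop.1 hev
    rw [← (ENNReal.summable (f := fun n => _)).sum_add_tsum_nat_add' (k := n₀)]
    have hterm : ∀ n, ∫⁻ ω, (B a n).indicator (fun _ => ((n + 1 : ℕ) : ℝ≥0∞)) ω ∂P
        = ((n + 1 : ℕ) : ℝ≥0∞) * P (B a n) := fun n => lintegral_indicator_const (hB a n) _
    simp_rw [hterm]
    refine ENNReal.add_ne_top.2 ⟨ENNReal.sum_ne_top.2 fun n _ => ?_, ?_⟩
    · exact ENNReal.mul_ne_top (ENNReal.natCast_ne_top _) (measure_ne_top _ _)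
    · have hsum := (((summable_nat_add_iff n₀).2 (summable_mul_exp_neg_rpow hc hγ)).mul_left
        2).tsum_ofReal_ne_top
      refine ne_top_of_le_ne_top hsum (ENNReal.tsum_le_tsum fun n => ?_)
      refine (mul_le_mul_right (hn₀ (n + n₀) (by omega)) _).trans (le_of_eq ?_)
      rw [← ENNReal.ofReal_natCast, ← ENNReal.ofReal_mul (by positivity)]
      congr 1
      push_cast
      ring
  refine ⟨fun ω => ⌈(S ω).toReal⌉₊, hSm.ennreal_toReal.nat_ceil, ?_, ?_⟩
  · have h1 := (integrable_toReal_of_lintegral_ne_top hSm.aemeasurable hSi).add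
      (integrable_const (1 : ℝ))
    refine h1.mono' (measurable_from_nat.comp hSm.ennreal_toReal.nat_ceil).aestronglyMeasurable
      (Eventually.of_forall fun ω => ?_)
    rw [Real.norm_eq_abs, abs_of_nonneg (Nat.cast_nonneg _)]
    exact (Nat.ceil_lt_add_one ENNReal.toReal_nonneg).le
  · filter_upwards [ae_lt_top hSm hSi] with ω hω n hn a hmem
    have h1 : ((n + 1 : ℕ) : ℝ≥0∞) ≤ S ω := by
      calc ((n + 1 : ℕ) : ℝ≥0∞) = (B a n).indicator (fun _ => ((n + 1 : ℕ) : ℝ≥0∞)) ω := by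
            rw [indicator_of_mem hmem]
        _ ≤ ∑' k, (B a k).indicator (fun _ => ((k + 1 : ℕ) : ℝ≥0∞)) ω :=
            ENNReal.le_tsum (f := fun k => (B a k).indicator (fun _ => ((k + 1 : ℕ) : ℝ≥0∞)) ω) n
        _ ≤ S ω := Finset.single_le_sum
            (f := fun a => ∑' k, (B a k).indicator (fun _ => ((k + 1 : ℕ) : ℝ≥0∞)) ω)
            (fun _ _ => zero_le) (Finset.mem_univ a)
    have h2 := ENNReal.toReal_mono hω.ne h1
    rw [ENNReal.toReal_natCast] at h2
    have h3 : n + 1 ≤ ⌈(S ω).toReal⌉₊ := by exact_mod_cast h2.trans (Nat.le_ceil _)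
    omega

end Concentration

end AnchoredTopTwo

theorem proposition3p1 {K : ℕ} (hK : 2 ≤ K) (ρ : Measure ℝ)
    (hρ : AnchoredTopTwo.Nondegenerate ρ)
    (μ : Fin K → ℝ) (hμ : ∀ a, μ a ∈ AnchoredTopTwo.meanSpace ρ)
    (i₁ : Fin K) (hi₁ : ∀ a, a ≠ i₁ → μ a < μ i₁) :
    ∃ ωstar : Fin K → ℝ,
      AnchoredTopTwo.IsOptimalAllocation ρ μ i₁ ωstar ∧
      (∀ w, AnchoredTopTwo.IsOptimalAllocation ρ μ i₁ w → w = ωstar) ∧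
      0 < AnchoredTopTwo.epsConst ρ μ i₁ ∧
      ∀ (α : ℝ), 0 < α → α < 1 → ∀ v : AnchoredTopTwo.Variant,
        ∃ C₁ : ℝ, 0 < C₁ ∧
          ∀ (Ω : Type*) [mΩ : MeasurableSpace Ω] (P : Measure Ω) [IsProbabilityMeasure P]
            (𝓕 : Filtration ℕ mΩ) (A : ℕ → Ω → Fin K) (X : ℕ → Ω → ℝ),
            AnchoredTopTwo.IsRun v ρ μ α P 𝓕 A X →
            ∃ T : Ω → ℕ, Measurable T ∧ Integrable (fun ω => (T ω : ℝ)) P ∧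
              ∀ᵐ ω ∂P, ∀ N : ℕ, T ω ≤ N → ∀ a : Fin K,
                |AnchoredTopTwo.pulls A N ω a / (N : ℝ) - ωstar a|
                    ≤ C₁ * (N : ℝ) ^ (-(3 * α / 8)) ∧
                |AnchoredTopTwo.empMean A X N ω a - μ a|
                    ≤ AnchoredTopTwo.epsConst ρ μ i₁ * (N : ℝ) ^ (-(3 * α / 8)) := by
  obtain ⟨r, w, hr⟩ := AnchoredTopTwo.exists_isBalanced hK hρ hμ hi₁
  have hε := AnchoredTopTwo.epsConst_pos hK hρ hμ hi₁
  refine ⟨AnchoredTopTwo.allocation r, hr.isOptimalAllocation hK hρ hμ hi₁,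
    fun N hN => hr.eq_allocation hK hρ hμ hi₁ hN, hε, fun α hα₀ hα v => ?_⟩
  obtain ⟨C, hC, L, hL0, hL⟩ := AnchoredTopTwo.exists_abs_count_div_sub_le (v := v) hK hρ hμ hi₁ hr
    hα₀.le hα (β := 3 * α / 8) (by positivity) (by linarith) hε
  refine ⟨C, hC, fun Ω mΩ P _ 𝓕 A X hrun => ?_⟩
  obtain ⟨T, hTm, hTi, hT⟩ := AnchoredTopTwo.exists_integrable_time (P := P)
    (fun a n => hrun.measurableSet_deviation n a
      (AnchoredTopTwo.epsConst ρ μ i₁ * (n : ℝ) ^ (-(3 * α / 8))))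
    (by positivity : 0 < α / 4) (hrun.exists_measure_empMean_le hK hρ hμ hα₀ hα hε)
  refine ⟨fun ω => L * (T ω + 1), (hTm.add_const 1).const_mul L, ?_, ?_⟩
  · have := (hTi.add (integrable_const (1 : ℝ))).const_mul (L : ℝ)
    refine this.congr (Filter.Eventually.of_forall fun ω => ?_)
    simp
  · filter_upwards [hT] with ω hω N hN a
    have hclose : ∀ n, T ω ≤ n → ∀ a, |AnchoredTopTwo.empMean A X n ω a - μ a|
        ≤ AnchoredTopTwo.epsConst ρ μ i₁ * (n : ℝ) ^ (-(3 * α / 8)) :=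
      fun n hn a => not_lt.1 (hω n hn a)
    refine ⟨hL (fun k => A k ω) (fun k => AnchoredTopTwo.empMean A X k ω) (T ω)
      ⟨fun n => hrun.rule n ω, hclose⟩ N hN a, hclose N ?_ a⟩
    have : T ω + 1 ≤ L * (T ω + 1) := Nat.le_mul_of_pos_left _ hL0
    omega
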